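/- Let $K$ be a field and let $A=K[a_1,\dots,a_n]$ be a solvable polynomial algebra with PBW $K$-basis $\mathcal B=\{a^\alpha=a_1^{\alpha_1}\cdots a_n^{\alpha_n}\mid\alpha\in\mathbb N^n\}$ and monomial ordering $\prec_{gr}$. Here a monomial ordering is a total well-ordering of $\mathcal B$ such that, writing $\mathrm{LM}$ for leading monomials, (a) if $a^\gamma=\mathrm{LM}(a^\alpha a^\beta a^\eta)$, $a^\gamma\ne1$ and $a^\beta\ne a^\gamma$, then $a^\beta\prec_{gr}a^\gamma$; (b) if $a^\alpha\prec_{gr}a^\beta$, $a^\gamma a^\alpha a^\eta\ne0$, $a^\gamma a^\beta a^\eta\neq0$ and $\mathrm{LM}(a^\gamma a^\beta a^\eta)\ne1$, then $\mathrm{LM}(a^\gamma a^\alpha a^\eta)\prec_{gr}\mathrm{LM}(a^\gamma a^\beta a^\eta)$. Solvability means that for all $\alpha,\beta$ we have $a^\alpha a^\beta=\lambda_{\alpha,\beta}a^{\alpha+\beta}+f_{\alpha,\beta}$ with $0\ne\lambda_{\alpha,\beta}\in K$ and either $f_{\alpha,\beta}=0$ or $\mathrm{LM}(f_{\alpha,\beta})\prec_{gr}a^{\alpha+\beta}$.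 Assume that $\prec_{gr}$ is graded with respect to a positive-degree function $d$, $d(a^\alpha)=\sum_i\alpha_im_i$ with integers $m_i>0$: $a^\alpha\prec_{gr}a^\beta$ implies $d(a^\alpha)\le d(a^\beta)$. Filter $A$ by $F_pA=K\text{-span}\{a^\alpha\mid d(a^\alpha)\le p\}$, $p\in\mathbb N$. Let $L=\bigoplus_{i=1}^sAe_i$ be a free left $A$-module, let $b_1,\dots,b_s\in\mathbb N$, and filter $L$ by $F_qL=K\text{-span}\{a^\alpha e_i\mid d(a^\alpha)+b_i\le q\}$, $q\in\mathbb N$. Let $\prec_{e\text{-}gr}$ be a graded left monomial ordering on $\mathcal B(e)=\{a^\alpha e_i\}$: a total ordering such that $u\prec_{e\text{-}gr}v$ implies $\mathrm{LM}(a^\gamma u)\prec_{e\text{-}gr}\mathrm{LM}(a^\gamma v)$ for all $\gamma$, $a^\alpha\prec_{gr}a^\beta$ implies $a^\alpha e_i\prec_{e\text{-}gr}a^\beta e_i$, and $a^\alpha e_i\prec_{e\text{-}gr}a^\beta e_j$ implies $d(a^\alpha)+b_i\le d(a^\beta)+b_j$. Let $G(A)=\bigoplus_pF_pA/F_{p-1}A$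 and $G(L)=\bigoplus_qF_qL/F_{q-1}L$ (with $F_{-1}=0$) be the associated graded algebra and module, and let $\widetilde A=\bigoplus_pF_pA$ and $\widetilde L=\bigoplus_qF_qL$ be the Rees algebra and the Rees module. For a nonzero element $\xi$ of $A$ or $L$ whose filtered degree (the least $q$ such that $\xi$ lies in the $q$-th filtration step) is $q$, let $\sigma(\xi)$ be its class in degree $q$ of the associated graded object, and let $\widetilde\xi$ be $\xi$ regarded as an element of degree $q$ of the Rees object. Let $Z\in\widetilde A$ be the element $1$ placed in degree $1$. Order the $K$-basis $\{\sigma(a)^\alpha\sigma(e_i)\}$ of $G(L)$ by $$\sigma(a)^\alpha\sigma(e_i)\prec_{\sigma(e)\text{-}gr}\sigma(a)^\beta\sigma(e_j)\iff a^\alpha e_i\prec_{e\text{-}gr}a^\beta e_j,$$ and the $K$-basis $\{\widetilde a^{\,\alpha}Z^k\widetilde e_i\}$ of $\widetilde L$ by $$\widetilde a^{\,\alpha}Z^k\widetilde e_i\prec_{\widetilde e}\widetilde a^{\,\beta}Z^l\widetilde e_j\iff a^\alpha e_i\prec_{e\text{-}gr}a^\beta e_j,\ \text{or}\ a^\alpha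 e_i=a^\beta e_j\ \text{and}\ k<l.$$ A left Gröbner basis of a submodule of one of the free modules $L$, $G(L)$, $\widetilde L$, with respect to the given ordering of its monomials, is a set of nonzero elements of the submodule such that the leading monomial of each nonzero element of the submodule is divisible from the left by the leading monomial of some element of the set; here a monomial $u$ divides a monomial $v$ from the left if $u$ and $v$ involve the same basis element of the free module and $v=\mathrm{LM}(mu)$ for some monomial $m$ of the algebra. Let $N$ be an $A$-submodule of $L$ with the induced filtration $F_qN=F_qL\cap N$, and regard $G(N)=\bigoplus_qF_qN/F_{q-1}N$ and $\widetilde N=\bigoplus_qF_qN$ as submodules of $G(L)$ and $\widetilde L$. For every subset $\mathcal G\subseteq N$: 1. $\mathcal G$ is a left Gröbner basis of $N$ with respect to $\prec_{e\text{-}gr}$ if and only if $\sigma(\mathcal G)=\{\sigma(g)\mid g\in\mathcal G\}$ is a left Gröbner basis of the $G(A)$-module $G(N)$ with respect to $\prec_{\sigma(e)\text{-}gr}$. 2. $\mathcal G$ is a left Gröbner basis of $N$ with respect to $\prec_{e\text{-}gr}$ if and only if $\tau(\mathcal G)=\{\widetilde g\mid g\in\mathcal G\}$ is a left Gröbner basis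 of the $\widetilde A$-module $\widetilde N$ with respect to $\prec_{\widetilde e}$. (Here $\sigma(0)=0$ and $\widetilde0=0$, so that none of the three sets is a left Gröbner basis if $0\in\mathcal G$.) -/

import Mathlib

open scoped DirectSum

/-! ### Monomials, leading monomials and left Gröbner bases -/

/-- The monomial `x₁ ^ α₁ * ⋯ * xₙ ^ αₙ` (in this order) in elements `x₁, …, xₙ` of a ring. -/
def pbwMonomial {R : Type*} [Semiring R] {n : ℕ} (x : Fin n → R) (α : Fin n → ℕ) : R :=
  (List.ofFn fun i => x i ^ α i).prod

/-- The monomial `x ^ α • eᵢ` of a module, for `u = (α, i)`. -/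
def moduleMonomial {R M : Type*} [Semiring R] [AddCommMonoid M] [Module R M] {n s : ℕ}
    (x : Fin n → R) (e : Fin s → M) (u : (Fin n → ℕ) × Fin s) : M :=
  pbwMonomial x u.1 • e u.2

/-- For a `K`-basis `v` whose index set is ordered by `r`: the basis element `v i` is the leading
monomial of `y`, that is, `v i` occurs in the expression of `y` in the basis, and all other basis
elements that occur are `r`-smaller. In particular `y ≠ 0`. -/
def IsLeadingMonomial (K : Type*) {ι V : Type*} [Field K] [AddCommMonoid V] [Module K V]
    (v : ι → V) (r : ι → ι → Prop) (y : V) (i : ι) : Prop :=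
  ∃ c : ι →₀ K, Finsupp.linearCombination K v c = y ∧ c i ≠ 0 ∧
    ∀ j ∈ c.support, j ≠ i → r j i

/-- Left division of monomials of a module: `x ^ α • eᵢ` divides `x ^ β • eⱼ` if `i = j` and
`x ^ β • eⱼ` is the leading monomial of `x ^ γ • (x ^ α • eᵢ)` for some `γ`. -/
def MonomialLeftDvd (K : Type*) {R M : Type*} [Field K] [Semiring R] [AddCommMonoid M]
    [Module R M] [Module K M] {n s : ℕ} (x : Fin n → R) (e : Fin s → M)
    (r : (Fin n → ℕ) × Fin s → (Fin n → ℕ) × Fin s → Prop) (u v : (Fin n → ℕ) × Fin s) : Prop :=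
  u.2 = v.2 ∧ ∃ γ : Fin n → ℕ,
    IsLeadingMonomial K (moduleMonomial x e) r (pbwMonomial x γ • moduleMonomial x e u) v

/-- `G` is a left Gröbner basis of the submodule `N`, with respect to the ordering `r` of the
monomials `x ^ α • eᵢ`: `G` consists of nonzero elements of `N`, and the leading monomial of every
nonzero element of `N` is divisible from the left by the leading monomial of an element of `G`. -/
def IsLeftGroebnerBasis (K : Type*) {R M : Type*} [Field K] [Semiring R] [AddCommMonoid M]
    [Module R M] [Module K M] {n s : ℕ} (x : Fin n → R) (e : Fin s → M)
    (r : (Fin n → ℕ) × Fin s → (Fin n → ℕ) × Fin s → Prop)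
    (N : Submodule R M) (G : Set M) : Prop :=
  (∀ g ∈ G, g ∈ N ∧ g ≠ 0) ∧
    ∀ ξ ∈ N, ξ ≠ 0 → ∃ g ∈ G, ∃ u v,
      IsLeadingMonomial K (moduleMonomial x e) r g u ∧
      IsLeadingMonomial K (moduleMonomial x e) r ξ v ∧
      MonomialLeftDvd K x e r u v

/-! ### Solvable polynomial algebras and orderings -/

/-- The weighted degree `d(x ^ α) = ∑ αᵢ mᵢ` of a monomial. -/
def monomialDegree {n : ℕ} (m : Fin n → ℕ) (α : Fin n → ℕ) : ℕ := ∑ i, α i * m i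

/-- A (two-sided) monomial ordering on the PBW basis `x ^ α`, as a strict well-ordering of the
exponents. -/
structure IsMonomialOrdering (K : Type*) {A : Type*} [Field K] [Ring A] [Algebra K A] {n : ℕ}
    (x : Fin n → A) (r : (Fin n → ℕ) → (Fin n → ℕ) → Prop) : Prop where
  isWellOrder : IsWellOrder (Fin n → ℕ) r
  lt_of_isLeadingMonomial : ∀ α β γ η : Fin n → ℕ, γ ≠ 0 → β ≠ γ →
    IsLeadingMonomial K (pbwMonomial x) r
      (pbwMonomial x α * pbwMonomial x β * pbwMonomial x η) γ → r β γ
  lt_of_lt : ∀ α β γ η μ ν : Fin n → ℕ, r α β →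
    IsLeadingMonomial K (pbwMonomial x) r
      (pbwMonomial x γ * pbwMonomial x α * pbwMonomial x η) μ →
    IsLeadingMonomial K (pbwMonomial x) r
      (pbwMonomial x γ * pbwMonomial x β * pbwMonomial x η) ν → ν ≠ 0 → r μ ν

/-- A solvable polynomial algebra structure on the `K`-algebra `A`: generators `a₁, …, aₙ` whose
monomials `a ^ α` form a `K`-basis, a monomial ordering `lt` for which
`a ^ α * a ^ β = c • a ^ (α + β) + f` with `c ≠ 0` and `f = 0` or `LM(f) ≺ a ^ (α + β)`, together
with a positive-degree function with respect to which `lt` is a graded monomial ordering. -/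
structure GradedSolvableAlgebra (K A : Type*) [Field K] [Ring A] [Algebra K A] (n : ℕ) where
  /-- the generators `a₁, …, aₙ` -/
  gen : Fin n → A
  linearIndependent_pbw : LinearIndependent K (pbwMonomial gen)
  span_pbw : Submodule.span K (Set.range (pbwMonomial gen)) = ⊤
  /-- the monomial ordering -/
  lt : (Fin n → ℕ) → (Fin n → ℕ) → Prop
  isMonomialOrdering : IsMonomialOrdering K gen lt
  solvable : ∀ α β : Fin n → ℕ, ∃ c : K, c ≠ 0 ∧ ∃ f : A,
    pbwMonomial gen α * pbwMonomial gen β = c • pbwMonomial gen (α + β) + f ∧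
    (f ≠ 0 → ∃ μ, IsLeadingMonomial K (pbwMonomial gen) lt f μ ∧ lt μ (α + β))
  /-- the degrees `m₁, …, mₙ` of the generators -/
  weight : Fin n → ℕ
  weight_pos : ∀ i, 0 < weight i
  degree_le_of_lt : ∀ α β, lt α β → monomialDegree weight α ≤ monomialDegree weight β

/-! ### Associated graded modules and Rees modules of filtrations by `K`-subspaces -/

section Filtration

variable {K V : Type*} [Field K] [AddCommGroup V] [Module K V]

/-- The previous filtration step `F_{p-1}`, with `F_{-1} = 0`. -/
def filtrationPred (F : ℕ → Submodule K V) : ℕ → Submodule K V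
  | 0 => ⊥
  | p + 1 => F p

/-- The piece `G(V)_p = F_p V / F_{p-1} V` of the associated graded module. -/
def GrPiece (F : ℕ → Submodule K V) (p : ℕ) : Type _ :=
  F p ⧸ (filtrationPred F p).submoduleOf (F p)

instance (F : ℕ → Submodule K V) (p : ℕ) : AddCommGroup (GrPiece F p) :=
  inferInstanceAs (AddCommGroup (F p ⧸ (filtrationPred F p).submoduleOf (F p)))

instance (F : ℕ → Submodule K V) (p : ℕ) : Module K (GrPiece F p) :=
  inferInstanceAs (Module K (F p ⧸ (filtrationPred F p).submoduleOf (F p)))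

/-- The class `ξ + F_{p-1} V` of `ξ ∈ F_p V`. -/
def GrPiece.mk (F : ℕ → Submodule K V) (p : ℕ) : F p →ₗ[K] GrPiece F p :=
  ((filtrationPred F p).submoduleOf (F p)).mkQ

/-- The associated graded module `G(V) = ⨁ F_p V / F_{p-1} V`. -/
abbrev AssocGraded (F : ℕ → Submodule K V) : Type _ := ⨁ p, GrPiece F p

/-- The Rees module `⨁ F_p V`. -/
abbrev ReesModule (F : ℕ → Submodule K V) : Type _ := ⨁ p, F p

open Classical in
/-- The principal symbol `σ(ξ)`: the class of `ξ` in `G(V)_q`, where `q` is the filtered degree of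
`ξ`, that is, the least `q` with `ξ ∈ F_q V`. -/
noncomputable def principalSymbol (F : ℕ → Submodule K V) (ξ : V) : AssocGraded F :=
  if h : ∃ q, ξ ∈ F q then
    DirectSum.of (GrPiece F) (Nat.find h) (GrPiece.mk F (Nat.find h) ⟨ξ, Nat.find_spec h⟩)
  else 0

open Classical in
/-- The homogeneous element `ξ~` of the Rees module: `ξ` placed in degree `q`, where `q` is the
filtered degree of `ξ`, that is, the least `q` with `ξ ∈ F_q V`. -/
noncomputable def reesElement (F : ℕ → Submodule K V) (ξ : V) : ReesModule F :=
  if h : ∃ q, ξ ∈ F q then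
    DirectSum.of (fun q => F q) (Nat.find h) ⟨ξ, Nat.find_spec h⟩
  else 0

end Filtration

section FilteredAlgebra

variable {K A V : Type*} [Field K] [Ring A] [Algebra K A] [AddCommGroup V] [Module K V]
  [Module A V]

theorem GrPiece.mk_surjective (F : ℕ → Submodule K V) (p : ℕ) :
    Function.Surjective (GrPiece.mk F p) :=
  Submodule.mkQ_surjective _

theorem GrPiece.sigma_mk_eq (F : ℕ → Submodule K V) {p q : ℕ} (h : p = q) (x : F p) (y : F q)
    (hxy : (x : V) = y) :
    (⟨p, GrPiece.mk F p x⟩ : GradedMonoid (GrPiece F)) = ⟨q, GrPiece.mk F q y⟩ := by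
  subst h
  rw [Subtype.ext hxy]

theorem smul_mem_filtrationPred_right (F : ℕ → Submodule K A) (FV : ℕ → Submodule K V)
    [SetLike.GradedSMul F FV] (p q : ℕ) {a : A} {ξ : V} (ha : a ∈ F p)
    (hξ : ξ ∈ filtrationPred FV q) : a • ξ ∈ filtrationPred FV (p + q) := by
  cases q with
  | zero =>
    have h0 : ξ = 0 := hξ
    rw [h0, smul_zero]
    exact zero_mem _
  | succ q =>
    have h := SetLike.GradedSMul.smul_mem (A := F) (B := FV) ha (show ξ ∈ FV q from hξ)
    exact h

theorem smul_mem_filtrationPred_left (F : ℕ → Submodule K A) (FV : ℕ → Submodule K V)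
    [SetLike.GradedSMul F FV] (p q : ℕ) {a : A} {ξ : V} (ha : a ∈ filtrationPred F p)
    (hξ : ξ ∈ FV q) : a • ξ ∈ filtrationPred FV (p + q) := by
  cases p with
  | zero =>
    have h0 : a = 0 := ha
    rw [h0, zero_smul]
    exact zero_mem _
  | succ p =>
    have h := SetLike.GradedSMul.smul_mem (A := F) (B := FV) (show a ∈ F p from ha) hξ
    rw [show p + 1 + q = (p + q) + 1 by omega]
    exact h

variable [IsScalarTower K A V]

/-- The bilinear map `(f, ξ) ↦ f • ξ + F_{p+q-1} V`. -/
def GrPiece.preSmul (F : ℕ → Submodule K A) (FV : ℕ → Submodule K V) [SetLike.GradedSMul F FV]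
    (p q : ℕ) : F p →ₗ[K] FV q →ₗ[K] GrPiece FV (p + q) :=
  (LinearMap.mk₂ K (fun (f : F p) (ξ : FV q) => (⟨(f : A) • (ξ : V),
      SetLike.GradedSMul.smul_mem (A := F) (B := FV) f.2 ξ.2⟩ : FV (p + q)))
    (fun f g ξ => Subtype.ext (add_smul (f : A) (g : A) (ξ : V)))
    (fun c f ξ => Subtype.ext (smul_assoc c (f : A) (ξ : V)))
    (fun f ξ ζ => Subtype.ext (smul_add (f : A) (ξ : V) (ζ : V)))
    (fun c f ξ => Subtype.ext (smul_comm (f : A) c (ξ : V)))).compr₂ (GrPiece.mk FV (p + q))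

/-- The product `(f + F_{p-1} A) • (ξ + F_{q-1} V) = f • ξ + F_{p+q-1} V`. -/
def GrPiece.smul (F : ℕ → Submodule K A) (FV : ℕ → Submodule K V) [SetLike.GradedSMul F FV]
    (p q : ℕ) : GrPiece F p →ₗ[K] GrPiece FV q →ₗ[K] GrPiece FV (p + q) :=
  Submodule.liftQ _
    (Submodule.liftQ ((filtrationPred FV q).submoduleOf (FV q)) (GrPiece.preSmul F FV p q).flip
      (fun ξ hξ => LinearMap.ext fun f => (Submodule.Quotient.mk_eq_zero _).2
        (smul_mem_filtrationPred_right F FV p q f.2 hξ))).flip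
    (by
      intro f hf
      refine LinearMap.ext fun y => ?_
      obtain ⟨ξ, rfl⟩ := GrPiece.mk_surjective FV q y
      exact (Submodule.Quotient.mk_eq_zero _).2
        (smul_mem_filtrationPred_left F FV p q hf ξ.2))

theorem GrPiece.smul_mk_mk (F : ℕ → Submodule K A) (FV : ℕ → Submodule K V)
    [SetLike.GradedSMul F FV] (p q : ℕ) (f : F p) (ξ : FV q) :
    GrPiece.smul F FV p q (GrPiece.mk F p f) (GrPiece.mk FV q ξ) =
      GrPiece.mk FV (p + q) ⟨(f : A) • (ξ : V),
        SetLike.GradedSMul.smul_mem (A := F) (B := FV) f.2 ξ.2⟩ := rfl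

/-- The unit and the product `(f + F_{p-1} A) * (g + F_{q-1} A) = f * g + F_{p+q-1} A` of
`G(A)`. -/
instance (F : ℕ → Submodule K A) [SetLike.GradedMonoid F] : GradedMonoid.GOne (GrPiece F) where
  one := GrPiece.mk F 0 ⟨1, SetLike.GradedOne.one_mem⟩

instance (F : ℕ → Submodule K A) [SetLike.GradedMonoid F] : GradedMonoid.GMul (GrPiece F) where
  mul {p q} x y := GrPiece.smul F F p q x y

instance (F : ℕ → Submodule K A) [SetLike.GradedMonoid F] : GradedMonoid.GMonoid (GrPiece F) where
  one_mul := by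
    rintro ⟨p, x⟩
    obtain ⟨f, rfl⟩ := GrPiece.mk_surjective F p x
    exact GrPiece.sigma_mk_eq F (zero_add p) _ _ (one_mul (f : A))
  mul_one := by
    rintro ⟨p, x⟩
    obtain ⟨f, rfl⟩ := GrPiece.mk_surjective F p x
    exact GrPiece.sigma_mk_eq F (add_zero p) _ _ (mul_one (f : A))
  mul_assoc := by
    rintro ⟨p, x⟩ ⟨q, y⟩ ⟨t, z⟩
    obtain ⟨f, rfl⟩ := GrPiece.mk_surjective F p x
    obtain ⟨g, rfl⟩ := GrPiece.mk_surjective F q y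
    obtain ⟨h, rfl⟩ := GrPiece.mk_surjective F t z
    exact GrPiece.sigma_mk_eq F (add_assoc p q t) _ _ (mul_assoc (f : A) g h)

/-- `G(A) = ⨁ F_p A / F_{p-1} A` is a graded ring. -/
instance (F : ℕ → Submodule K A) [SetLike.GradedMonoid F] : DirectSum.GRing (GrPiece F) where
  mul_zero {p q} x := map_zero (GrPiece.smul F F p q x)
  zero_mul {p q} y := LinearMap.map_zero₂ (GrPiece.smul F F p q) y
  mul_add {p q} x y z := map_add (GrPiece.smul F F p q x) y z
  add_mul {p q} x y z := LinearMap.map_add₂ (GrPiece.smul F F p q) x y z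
  natCast k := k • (GradedMonoid.GOne.one : GrPiece F 0)
  natCast_zero := zero_smul _ _
  natCast_succ _ := succ_nsmul _ _
  intCast k := k • (GradedMonoid.GOne.one : GrPiece F 0)
  intCast_ofNat _ := natCast_zsmul _ _
  intCast_negSucc_ofNat _ := negSucc_zsmul _ _

/-- `G(V)` is a graded `G(A)`-module. -/
instance (F : ℕ → Submodule K A) (FV : ℕ → Submodule K V) [SetLike.GradedMonoid F]
    [SetLike.GradedSMul F FV] : DirectSum.Gmodule (GrPiece F) (GrPiece FV) where
  smul {p q} x y := GrPiece.smul F FV p q x y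
  one_smul := by
    rintro ⟨p, x⟩
    obtain ⟨f, rfl⟩ := GrPiece.mk_surjective FV p x
    exact GrPiece.sigma_mk_eq FV (zero_add p) _ _ (one_smul A (f : V))
  mul_smul := by
    rintro ⟨p, x⟩ ⟨q, y⟩ ⟨t, z⟩
    obtain ⟨f, rfl⟩ := GrPiece.mk_surjective F p x
    obtain ⟨g, rfl⟩ := GrPiece.mk_surjective F q y
    obtain ⟨h, rfl⟩ := GrPiece.mk_surjective FV t z
    exact GrPiece.sigma_mk_eq FV (add_assoc p q t) _ _ (mul_smul (f : A) (g : A) (h : V))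
  smul_add {p q} x y z := map_add (GrPiece.smul F FV p q x) y z
  smul_zero {p q} x := map_zero (GrPiece.smul F FV p q x)
  add_smul {p q} x y z := LinearMap.map_add₂ (GrPiece.smul F FV p q) x y z
  zero_smul {p q} y := LinearMap.map_zero₂ (GrPiece.smul F FV p q) y

/-- The submodule `G(N) = ⨁ F_q N / F_{q-1} N` of `G(V)`, for the induced filtration
`F_q N = F_q V ∩ N`: its degree `q` part consists of the classes of the elements of `F_q V ∩ N`. -/
def assocGradedSubmodule (F : ℕ → Submodule K A) (FV : ℕ → Submodule K V)
    [SetLike.GradedMonoid F] [SetLike.GradedSMul F FV] (N : Submodule A V) :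
    Submodule (AssocGraded F) (AssocGraded FV) :=
  let P : AddSubmonoid (AssocGraded FV) :=
    { carrier := {x | ∀ q, ∃ ξ : FV q, (ξ : V) ∈ N ∧ x q = GrPiece.mk FV q ξ}
      zero_mem' := fun q => ⟨0, N.zero_mem, (map_zero _).symm⟩
      add_mem' := by
        intro x y hx hy q
        obtain ⟨ξ, hξ, hx⟩ := hx q
        obtain ⟨ζ, hζ, hy⟩ := hy q
        exact ⟨ξ + ζ, N.add_mem hξ hζ, by rw [DirectSum.add_apply, hx, hy, map_add]⟩ }
  { P with
    smul_mem' := by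
      have hof : ∀ (q : ℕ) (ξ : FV q), (ξ : V) ∈ N →
          DirectSum.of (GrPiece FV) q (GrPiece.mk FV q ξ) ∈ P := by
        intro q ξ hξ t
        by_cases h : q = t
        · subst h
          exact ⟨ξ, hξ, DirectSum.of_eq_same _ _⟩
        · exact ⟨0, N.zero_mem, by rw [DirectSum.of_eq_of_ne _ _ _ (Ne.symm h), map_zero]⟩
      intro c x hx
      change c • x ∈ P
      induction c using DirectSum.induction_on with
      | zero => rw [zero_smul]; exact P.zero_mem
      | add a b ha hb => rw [add_smul]; exact P.add_mem ha hb
      | of p f =>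
        classical
        obtain ⟨f, rfl⟩ := GrPiece.mk_surjective F p f
        rw [← DirectSum.sum_support_of x, Finset.smul_sum]
        refine P.sum_mem fun q _ => ?_
        obtain ⟨ξ, hξ, hq⟩ := hx q
        rw [hq, DirectSum.Gmodule.of_smul_of]
        exact hof (p + q) ⟨(f : A) • (ξ : V), _⟩ (N.smul_mem _ hξ) }

/-- The Rees module `⨁ F_q N` of `N` with the induced filtration `F_q N = F_q V ∩ N`, as a
submodule of the Rees module of `V`. -/
def reesSubmodule (F : ℕ → Submodule K A) (FV : ℕ → Submodule K V)
    [SetLike.GradedMonoid F] [SetLike.GradedSMul F FV] (N : Submodule A V) :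
    Submodule (ReesModule F) (ReesModule FV) :=
  let P : AddSubmonoid (ReesModule FV) :=
    { carrier := {x | ∀ q, (x q : V) ∈ N}
      zero_mem' := fun q => N.zero_mem
      add_mem' := by
        intro x y hx hy q
        exact N.add_mem (hx q) (hy q) }
  { P with
    smul_mem' := by
      have hof : ∀ (q : ℕ) (ξ : FV q), (ξ : V) ∈ N →
          DirectSum.of (fun q => FV q) q ξ ∈ P := by
        intro q ξ hξ t
        by_cases h : q = t
        · subst h
          rw [DirectSum.of_eq_same]
          exact hξ
        · rw [DirectSum.of_eq_of_ne _ _ _ (Ne.symm h)]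
          exact N.zero_mem
      intro c x hx
      change c • x ∈ P
      induction c using DirectSum.induction_on with
      | zero => rw [zero_smul]; exact P.zero_mem
      | add a b ha hb => rw [add_smul]; exact P.add_mem ha hb
      | of p f =>
        classical
        rw [← DirectSum.sum_support_of x, Finset.smul_sum]
        refine P.sum_mem fun q _ => ?_
        rw [DirectSum.Gmodule.of_smul_of]
        exact hof (p + q) ⟨(f : A) • (x q : V), _⟩ (N.smul_mem _ (hx q)) }

end FilteredAlgebra

/-! ### The filtrations of a solvable polynomial algebra and of its free modules -/

namespace GradedSolvableAlgebra

variable {K A L : Type*} [Field K] [Ring A] [Algebra K A] [AddCommGroup L] [Module K L]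
  [Module A L] [IsScalarTower K A L] {n s : ℕ}

/-- The positive-degree function on monomials. -/
def degree (S : GradedSolvableAlgebra K A n) (α : Fin n → ℕ) : ℕ := monomialDegree S.weight α

/-- `F_p A`, the `K`-span of the monomials of degree at most `p`. -/
def filtration (S : GradedSolvableAlgebra K A n) (p : ℕ) : Submodule K A :=
  Submodule.span K (pbwMonomial S.gen '' {α | S.degree α ≤ p})

/-- `F_q L`, the `K`-span of the monomials `a ^ α • eᵢ` with `d(a ^ α) + bᵢ ≤ q`. -/
def moduleFiltration (S : GradedSolvableAlgebra K A n) (e : Module.Basis (Fin s) A L)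
    (b : Fin s → ℕ) (q : ℕ) : Submodule K L :=
  Submodule.span K (moduleMonomial S.gen e '' {u | S.degree u.1 + b u.2 ≤ q})

theorem one_mem_filtration (S : GradedSolvableAlgebra K A n) (p : ℕ) :
    (1 : A) ∈ S.filtration p :=
  Submodule.subset_span ⟨0, by simp [degree, monomialDegree], by simp [pbwMonomial]⟩

theorem filtration_mono (S : GradedSolvableAlgebra K A n) {p q : ℕ} (h : p ≤ q) :
    S.filtration p ≤ S.filtration q :=
  Submodule.span_mono (Set.image_mono fun _ hα => le_trans hα h)

theorem pbwMonomial_mul_mem (S : GradedSolvableAlgebra K A n) (α β : Fin n → ℕ) :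
    pbwMonomial S.gen α * pbwMonomial S.gen β ∈ S.filtration (S.degree α + S.degree β) := by
  obtain ⟨c, -, f, hf, hlt⟩ := S.solvable α β
  have hd : S.degree (α + β) = S.degree α + S.degree β := by
    simp [degree, monomialDegree, add_mul, Finset.sum_add_distrib]
  rw [hf, ← hd]
  refine add_mem (Submodule.smul_mem _ _ (Submodule.subset_span ⟨_, le_refl (S.degree (α + β)), rfl⟩)) ?_
  by_cases h0 : f = 0
  · rw [h0]; exact zero_mem _
  · obtain ⟨μ, ⟨l, rfl, -, hl⟩, hμ⟩ := hlt h0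
    rw [Finsupp.linearCombination_apply]
    refine Submodule.sum_mem _ fun j hj =>
      Submodule.smul_mem _ _ (Submodule.subset_span ⟨j, ?_, rfl⟩)
    have h1 := S.degree_le_of_lt _ _ hμ
    by_cases hjμ : j = μ
    · rw [hjμ]; exact h1
    · exact (S.degree_le_of_lt _ _ (hl j hj hjμ)).trans h1

instance (S : GradedSolvableAlgebra K A n) : SetLike.GradedMonoid S.filtration where
  one_mem := S.one_mem_filtration 0
  mul_mem := by
    intro p q f g hf hg
    have h := Submodule.mul_mem_mul hf hg
    refine (?_ : S.filtration p * S.filtration q ≤ S.filtration (p + q)) h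
    rw [filtration, filtration, Submodule.span_mul_span, Submodule.span_le]
    rintro _ ⟨_, ⟨α, hα, rfl⟩, _, ⟨β, hβ, rfl⟩, rfl⟩
    exact S.filtration_mono (add_le_add hα hβ) (S.pbwMonomial_mul_mem α β)

theorem smul_basis_mem (S : GradedSolvableAlgebra K A n) (e : Module.Basis (Fin s) A L)
    (b : Fin s → ℕ) {p q : ℕ} {f : A} (hf : f ∈ S.filtration p) (i : Fin s) (h : p + b i ≤ q) :
    f • e i ∈ S.moduleFiltration e b q := by
  induction hf using Submodule.span_induction with
  | mem f hf =>
    obtain ⟨α, hα, rfl⟩ := hf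
    exact Submodule.subset_span ⟨(α, i), (Nat.add_le_add_right hα _).trans h, rfl⟩
  | zero => rw [zero_smul]; exact zero_mem _
  | add f g _ _ hf hg => rw [add_smul]; exact add_mem hf hg
  | smul c f _ hf => rw [smul_assoc]; exact Submodule.smul_mem _ _ hf

instance (S : GradedSolvableAlgebra K A n) (e : Module.Basis (Fin s) A L) (b : Fin s → ℕ) :
    SetLike.GradedSMul S.filtration (S.moduleFiltration e b) where
  smul_mem := by
    intro p q f ξ hf hξ
    change f • ξ ∈ S.moduleFiltration e b (p + q)
    induction hξ using Submodule.span_induction with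
    | mem ξ hξ =>
      obtain ⟨⟨β, i⟩, hβ, rfl⟩ := hξ
      rw [moduleMonomial, smul_smul]
      refine S.smul_basis_mem e b (p := p + S.degree β) ?_ i ?_
      · exact SetLike.GradedMonoid.toGradedMul.mul_mem hf
          (Submodule.subset_span ⟨β, le_refl (S.degree β), rfl⟩)
      · rw [add_assoc]
        exact Nat.add_le_add_left hβ p
    | zero => rw [smul_zero]; exact zero_mem _
    | add x y _ _ hx hy => rw [smul_add]; exact add_mem hx hy
    | smul c x _ hx => rw [smul_comm]; exact Submodule.smul_mem _ _ hx

/-- A graded left monomial ordering on the monomials `a ^ α • eᵢ` of the free module `L` with basis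
`e`, where `eᵢ` has degree `bᵢ`. -/
structure IsGradedLeftMonomialOrdering (S : GradedSolvableAlgebra K A n)
    (e : Module.Basis (Fin s) A L) (b : Fin s → ℕ)
    (r : (Fin n → ℕ) × Fin s → (Fin n → ℕ) × Fin s → Prop) : Prop where
  isStrictTotalOrder : IsStrictTotalOrder ((Fin n → ℕ) × Fin s) r
  lt_of_lt : ∀ (u v : (Fin n → ℕ) × Fin s) (γ : Fin n → ℕ) (μ ν : (Fin n → ℕ) × Fin s), r u v →
    IsLeadingMonomial K (moduleMonomial S.gen e) r
      (pbwMonomial S.gen γ • moduleMonomial S.gen e u) μ →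
    IsLeadingMonomial K (moduleMonomial S.gen e) r
      (pbwMonomial S.gen γ • moduleMonomial S.gen e v) ν → r μ ν
  lt_of_algebra_lt : ∀ (α β : Fin n → ℕ) (i : Fin s), S.lt α β → r (α, i) (β, i)
  degree_le_of_lt : ∀ u v : (Fin n → ℕ) × Fin s, r u v →
    S.degree u.1 + b u.2 ≤ S.degree v.1 + b v.2

/-- The generators `σ(a₁), …, σ(aₙ)` of `G(A)`. -/
noncomputable def grGen (S : GradedSolvableAlgebra K A n) : Fin n → AssocGraded S.filtration :=
  fun i => principalSymbol S.filtration (S.gen i)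

/-- The `G(A)`-basis `σ(e₁), …, σ(eₛ)` of `G(L)`. -/
noncomputable def grBasis (S : GradedSolvableAlgebra K A n) (e : Module.Basis (Fin s) A L)
    (b : Fin s → ℕ) : Fin s → AssocGraded (S.moduleFiltration e b) :=
  fun i => principalSymbol (S.moduleFiltration e b) (e i)

/-- The central element `Z` of the Rees algebra of `A`: the unit of `A`, placed in degree `1`. -/
def reesZ (S : GradedSolvableAlgebra K A n) : ReesModule S.filtration :=
  DirectSum.of (fun p => S.filtration p) 1 ⟨1, S.one_mem_filtration 1⟩

/-- The generators `a₁~, …, aₙ~, Z` of the Rees algebra of `A`. -/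
noncomputable def reesGen (S : GradedSolvableAlgebra K A n) :
    Fin (n + 1) → ReesModule S.filtration :=
  Fin.snoc (α := fun _ => ReesModule S.filtration)
    (fun i => reesElement S.filtration (S.gen i)) S.reesZ

/-- The basis `e₁~, …, eₛ~` of the Rees module of `L` over the Rees algebra of `A`. -/
noncomputable def reesBasis (S : GradedSolvableAlgebra K A n) (e : Module.Basis (Fin s) A L)
    (b : Fin s → ℕ) : Fin s → ReesModule (S.moduleFiltration e b) :=
  fun i => reesElement (S.moduleFiltration e b) (e i)

end GradedSolvableAlgebra

/-- The ordering of the monomials `a~ ^ α * Z ^ k • eᵢ~`, with exponents `(α, k)`, induced by the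
ordering `r` of the monomials `a ^ α • eᵢ`: compare first `a ^ α • eᵢ`, then the exponents of `Z`. -/
def reesOrdering {n s : ℕ} (r : (Fin n → ℕ) × Fin s → (Fin n → ℕ) × Fin s → Prop)
    (u v : (Fin (n + 1) → ℕ) × Fin s) : Prop :=
  r (fun i => u.1 i.castSucc, u.2) (fun i => v.1 i.castSucc, v.2) ∨
    ((fun i : Fin n => u.1 i.castSucc, u.2) = (fun i : Fin n => v.1 i.castSucc, v.2) ∧
      u.1 (Fin.last n) < v.1 (Fin.last n))

/-! ### Leading monomials in a basis -/

section LeadingMonomial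

variable {K ι V : Type*} [Field K] [AddCommGroup V] [Module K V] {r : ι → ι → Prop}

/-! Each of `L`, `G(L)` and the Rees module has a `K`-basis of monomials. That of `G(L)` has the
same index set as that of `L`. A basis element of the Rees module is a monomial `u` of `L` placed in
some degree `deg u + k`, so it corresponds to a pair `(u, k)`, with `k` the exponent of `Z`.

Since the ordering is graded, the leading monomial of `ξ` has the largest degree among its
monomials, and the filtered degree of `ξ` is the degree of `LM(ξ)`. Hence `σ(ξ)` has the same
leading monomial as `ξ` (`isLeadingMonomial_grVec_of_mk`), and the homogenization of `ξ` has this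
monomial with `Z`-exponent `0` (`isLeadingMonomial_reesVec_of`). Conversely, let `x` be a nonzero,
possibly inhomogeneous, element of `G(N)` or of the Rees module of `N`. Its component in the degree
of `LM(x)` comes from an element of `N` whose leading monomial is the one underlying `LM(x)`
(`isLeadingMonomial_of_grVec`, `isLeadingMonomial_of_reesVec`).

Finally, in all three modules the leading monomial of a product of monomials has the sum of the
exponents, so left division is addition of exponents (`monomialLeftDvd_iff`). The Gröbner conditions
are then the same condition on exponents; the extra variable `Z` imposes nothing, because the
divisors have `Z`-exponent `0`. -/

theorem isLeadingMonomial_iff (B : Module.Basis ι K V) (y : V) (i : ι) :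
    IsLeadingMonomial K B r y i ↔
      B.repr y i ≠ 0 ∧ ∀ j, B.repr y j ≠ 0 → j ≠ i → r j i := by
  constructor
  · rintro ⟨c, rfl, hi, h⟩
    rw [B.repr_linearCombination]
    exact ⟨hi, fun j hj => h j (Finsupp.mem_support_iff.2 hj)⟩
  · rintro ⟨hi, h⟩
    exact ⟨B.repr y, B.linearCombination_repr y, hi, fun j hj => h j (Finsupp.mem_support_iff.1 hj)⟩

theorem IsLeadingMonomial.ne_zero {B : Module.Basis ι K V} {y : V} {i : ι}
    (h : IsLeadingMonomial K B r y i) : y ≠ 0 := by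
  rintro rfl
  simp [isLeadingMonomial_iff] at h

theorem IsLeadingMonomial.unique {B : Module.Basis ι K V} (hr : ∀ i j, r i j → ¬ r j i) {y : V}
    {i j : ι} (hi : IsLeadingMonomial K B r y i) (hj : IsLeadingMonomial K B r y j) : i = j := by
  rw [isLeadingMonomial_iff] at hi hj
  by_contra hne
  exact hr _ _ (hj.2 i hi.1 hne) (hi.2 j hj.1 (Ne.symm hne))

/-- Supports are finite, so a total order suffices for leading monomials to exist; no
well-foundedness is needed. -/
theorem Finset.exists_forall_rel_of_trichotomous (htri : ∀ i j, i = j ∨ r i j ∨ r j i)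
    (htrans : ∀ i j k, r i j → r j k → r i k) (s : Finset ι) (hs : s.Nonempty) :
    ∃ i ∈ s, ∀ j ∈ s, j ≠ i → r j i := by
  classical
  induction hs using Finset.Nonempty.cons_induction with
  | singleton a => exact ⟨a, by simp, fun j hj h => absurd (Finset.mem_singleton.1 hj) h⟩
  | cons a s ha hs ih =>
    obtain ⟨i, hi, h⟩ := ih
    rcases htri a i with rfl | hai | hia
    · exact absurd hi ha
    · refine ⟨i, Finset.mem_cons_of_mem hi, fun j hj hji => ?_⟩
      rcases Finset.mem_cons.1 hj with rfl | hj
      · exact hai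
      · exact h j hj hji
    · refine ⟨a, Finset.mem_cons_self a s, fun j hj hja => ?_⟩
      rcases Finset.mem_cons.1 hj with rfl | hj
      · exact absurd rfl hja
      · by_cases hji : j = i
        · rwa [hji]
        · exact htrans _ _ _ (h j hj hji) hia

theorem exists_isLeadingMonomial (B : Module.Basis ι K V) (htri : ∀ i j, i = j ∨ r i j ∨ r j i)
    (htrans : ∀ i j k, r i j → r j k → r i k) {y : V} (hy : y ≠ 0) :
    ∃ i, IsLeadingMonomial K B r y i := by
  obtain ⟨i, hi, h⟩ := Finset.exists_forall_rel_of_trichotomous htri htrans (B.repr y).support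
    (Finsupp.support_nonempty_iff.2 (by simpa using hy))
  exact ⟨i, (isLeadingMonomial_iff B y i).2
    ⟨Finsupp.mem_support_iff.1 hi, fun j hj => h j (Finsupp.mem_support_iff.2 hj)⟩⟩

end LeadingMonomial

/-! ### Filtrations defined by a degree function on a basis -/

/-- `F_q V` is the span of the elements of degree at most `q` of the basis `B`. -/
def IsDegreeFiltration {K ι V : Type*} [Field K] [AddCommGroup V] [Module K V]
    (B : Module.Basis ι K V) (deg : ι → ℕ) (F : ℕ → Submodule K V) : Prop :=
  ∀ q ξ, ξ ∈ F q ↔ ∀ i, B.repr ξ i ≠ 0 → deg i ≤ q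

namespace IsDegreeFiltration

variable {K ι V : Type*} [Field K] [AddCommGroup V] [Module K V] {r : ι → ι → Prop}
  {B : Module.Basis ι K V} {deg : ι → ℕ} {F : ℕ → Submodule K V}

theorem of_eq_span (h : ∀ q, F q = Submodule.span K (B '' {i | deg i ≤ q})) :
    IsDegreeFiltration B deg F := by
  intro q ξ
  rw [h, B.mem_span_image]
  exact ⟨fun H i hi => H (Finsupp.mem_support_iff.2 hi),
    fun H i hi => H i (Finsupp.mem_support_iff.1 hi)⟩

theorem basis_mem_iff (hF : IsDegreeFiltration B deg F) (q : ℕ) (i : ι) :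
    B i ∈ F q ↔ deg i ≤ q := by
  classical
  rw [hF]
  constructor
  · intro h
    exact h i (by simp)
  · intro h j hj
    rw [B.repr_self, Finsupp.single_apply] at hj
    split_ifs at hj with hij
    · rwa [← hij]
    · exact absurd rfl hj

/-- The strict inequality covers `q = 0` as well: no degree is negative, in accordance with `F_{-1}
= 0`. -/
theorem mem_pred_iff (hF : IsDegreeFiltration B deg F) (q : ℕ) (ξ : V) :
    ξ ∈ filtrationPred F q ↔ ∀ i, B.repr ξ i ≠ 0 → deg i < q := by
  cases q with
  | zero =>
    change ξ ∈ (⊥ : Submodule K V) ↔ _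
    rw [Submodule.mem_bot]
    constructor
    · rintro rfl
      simp
    · intro h
      refine B.repr.map_eq_zero_iff.1 (Finsupp.ext fun i => ?_)
      by_contra hi
      exact absurd (h i hi) (Nat.not_lt_zero _)
  | succ q =>
    change ξ ∈ F q ↔ _
    rw [hF]
    simp only [Nat.lt_succ_iff]

/-- Gradedness enters here: every other monomial of `ξ` is smaller than `v`, hence of degree at most
`deg v`. So the filtered degree of `ξ` is `deg v`. -/
theorem mem_iff_of_isLeadingMonomial (hF : IsDegreeFiltration B deg F)
    (hr : ∀ i j, r i j → deg i ≤ deg j) {ξ : V} {v : ι} (hv : IsLeadingMonomial K B r ξ v)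
    (q : ℕ) : ξ ∈ F q ↔ deg v ≤ q := by
  rw [isLeadingMonomial_iff] at hv
  rw [hF]
  refine ⟨fun h => h v hv.1, fun h i hi => ?_⟩
  by_cases hiv : i = v
  · rwa [hiv]
  · exact (hr _ _ (hv.2 i hi hiv)).trans h

/-- The basis expansion takes place inside `F q`, so that linear maps defined only on `F q` can be
applied termwise; `attach` supplies the membership proofs. -/
theorem eq_sum_basis (hF : IsDegreeFiltration B deg F) {q : ℕ} {ξ : V} (hξ : ξ ∈ F q) :
    (⟨ξ, hξ⟩ : F q) = ∑ i ∈ (B.repr ξ).support.attach,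
      B.repr ξ i • ⟨B i, (hF.basis_mem_iff q i).2
        ((hF q ξ).1 hξ i (Finsupp.mem_support_iff.1 i.2))⟩ := by
  refine Subtype.ext ?_
  rw [AddSubmonoidClass.coe_finsetSum]
  simp only [Submodule.coe_smul]
  rw [Finset.sum_attach (B.repr ξ).support (fun i => B.repr ξ i • B i)]
  exact (B.linearCombination_repr ξ).symm

/-! #### The associated graded module -/

/-- The coordinate of a class in degree `deg i` with respect to `B i`. -/
noncomputable def pieceCoord (hF : IsDegreeFiltration B deg F) (i : ι) : GrPiece F (deg i) →ₗ[K] K :=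
  Submodule.liftQ _ ((B.coord i) ∘ₗ (F (deg i)).subtype) (by
    -- An element of the previous step involves only basis elements of degree below `deg i`, so its
    -- coordinate at `B i` vanishes.
    intro ξ hξ
    by_contra h
    exact lt_irrefl _ ((hF.mem_pred_iff _ _).1 hξ i h))

theorem pieceCoord_mk (hF : IsDegreeFiltration B deg F) (i : ι) (ξ : F (deg i)) :
    hF.pieceCoord i (GrPiece.mk F (deg i) ξ) = B.repr ξ i := rfl

/-- The class of `B i` in the associated graded module. -/
noncomputable def grVec (hF : IsDegreeFiltration B deg F) (i : ι) : AssocGraded F :=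
  DirectSum.of (GrPiece F) (deg i) (GrPiece.mk F (deg i) ⟨B i, (hF.basis_mem_iff _ i).2 le_rfl⟩)

/-- The coordinates of an element of the associated graded module. -/
noncomputable def grCoord (hF : IsDegreeFiltration B deg F) (i : ι) : AssocGraded F →ₗ[K] K :=
  hF.pieceCoord i ∘ₗ DirectSum.component K ℕ (GrPiece F) (deg i)

theorem grCoord_of_apply_eq (hF : IsDegreeFiltration B deg F) {i : ι} {q : ℕ} (hi : deg i = q)
    {x : AssocGraded F} {ξ : F q} (hx : x q = GrPiece.mk F q ξ) :
    hF.grCoord i x = B.repr ξ i := by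
  subst hi
  change hF.pieceCoord i (x (deg i)) = _
  rw [hx, pieceCoord_mk]

theorem grCoord_of_mk (hF : IsDegreeFiltration B deg F) (i : ι) (q : ℕ) (ξ : F q) :
    hF.grCoord i (DirectSum.of (GrPiece F) q (GrPiece.mk F q ξ)) =
      if deg i = q then B.repr ξ i else 0 := by
  split_ifs with h
  · exact hF.grCoord_of_apply_eq h (DirectSum.of_eq_same _ _)
  · change hF.pieceCoord i (DirectSum.of (GrPiece F) q _ (deg i)) = 0
    rw [DirectSum.of_eq_of_ne _ _ _ h, map_zero]

/-- Duality of the two families gives linear independence of `grVec` and identifies the coordinates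
with `grCoord`. -/
theorem grCoord_grVec [DecidableEq ι] (hF : IsDegreeFiltration B deg F) (i j : ι) :
    hF.grCoord i (hF.grVec j) = if j = i then 1 else 0 := by
  rw [grVec, grCoord_of_mk, B.repr_self, Finsupp.single_apply]
  by_cases h : j = i
  · simp [h]
  · simp [h]

theorem linearIndependent_grVec (hF : IsDegreeFiltration B deg F) :
    LinearIndependent K hF.grVec := by
  classical
  refine LinearIndependent.of_pairwise_dual_eq_zero_one _ hF.grCoord (fun i j hij => ?_)
    (fun i => ?_)
  · change hF.grCoord i (hF.grVec j) = 0
    rw [grCoord_grVec, if_neg (Ne.symm hij)]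
  · rw [grCoord_grVec, if_pos rfl]

/-- The basis of the associated graded module consisting of the classes of the elements of `B`. -/
noncomputable def grBasis (hF : IsDegreeFiltration B deg F) : Module.Basis ι K (AssocGraded F) :=
  Module.Basis.mk (v := hF.grVec)
    hF.linearIndependent_grVec
    (by
      rintro x -
      induction x using DirectSum.induction_on with
      | zero => exact zero_mem _
      | add x y hx hy => exact add_mem hx hy
      | of q x =>
        obtain ⟨⟨ξ, hξ⟩, rfl⟩ := GrPiece.mk_surjective F q x
        rw [hF.eq_sum_basis hξ, ← DirectSum.lof_eq_of K, map_sum, map_sum]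
        refine Submodule.sum_mem _ fun i _ => ?_
        rw [map_smul, map_smul]
        refine Submodule.smul_mem _ _ ?_
        have hi : deg i ≤ q := (hF q ξ).1 hξ i (Finsupp.mem_support_iff.1 i.2)
        -- Terms of degree exactly `q` give basis vectors; terms of lower degree vanish in the
        -- quotient.
        rcases hi.eq_or_lt with rfl | hi
        · exact Submodule.subset_span ⟨i, rfl⟩
        · have h0 : GrPiece.mk F q ⟨B i, (hF.basis_mem_iff q i).2 hi.le⟩ = 0 := by
            refine (Submodule.Quotient.mk_eq_zero _).2 ((hF.mem_pred_iff q (B i)).2 ?_)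
            classical
            intro j hj
            rw [B.repr_self, Finsupp.single_apply] at hj
            split_ifs at hj with hij
            · rwa [← hij]
            · exact absurd rfl hj
          rw [h0, map_zero]
          exact zero_mem _)

theorem coe_grBasis (hF : IsDegreeFiltration B deg F) : ⇑hF.grBasis = hF.grVec :=
  Module.Basis.coe_mk _ _

theorem grBasis_repr (hF : IsDegreeFiltration B deg F) (x : AssocGraded F) (i : ι) :
    hF.grBasis.repr x i = hF.grCoord i x := by
  classical
  have h : hF.grBasis.coord i = hF.grCoord i := by
    refine hF.grBasis.ext fun j => ?_
    rw [Module.Basis.coord_apply, Module.Basis.repr_self, Finsupp.single_apply, coe_grBasis,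
      grCoord_grVec]
  exact LinearMap.congr_fun h x

/-- Passing to the class in degree `deg v` only deletes coordinates of lower degree; the one at `v`
survives, and nothing new appears. -/
theorem isLeadingMonomial_grVec_of_mk (hF : IsDegreeFiltration B deg F) {ξ : V} {v : ι}
    (hv : IsLeadingMonomial K B r ξ v) (hξ : ξ ∈ F (deg v)) :
    IsLeadingMonomial K hF.grVec r
      (DirectSum.of (GrPiece F) (deg v) (GrPiece.mk F (deg v) ⟨ξ, hξ⟩)) v := by
  rw [← coe_grBasis]
  rw [isLeadingMonomial_iff] at hv ⊢
  simp only [grBasis_repr, grCoord_of_mk]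
  refine ⟨by simpa using hv.1, fun j hj hjv => hv.2 j ?_ hjv⟩
  rintro h
  simp [h] at hj

/-- The coordinates of `ξ` in degree exactly `deg v` are coordinates of `x`, hence controlled by
`hv`. Those of lower degree are invisible in `x`, but gradedness makes them smaller than `v`. -/
theorem isLeadingMonomial_of_grVec (hF : IsDegreeFiltration B deg F)
    (htri : ∀ i j, i = j ∨ r i j ∨ r j i) (hr : ∀ i j, r i j → deg i ≤ deg j)
    {x : AssocGraded F} {v : ι} (hv : IsLeadingMonomial K hF.grVec r x v) {ξ : F (deg v)}
    (hx : x (deg v) = GrPiece.mk F (deg v) ξ) : IsLeadingMonomial K B r (ξ : V) v := by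
  rw [← coe_grBasis] at hv
  rw [isLeadingMonomial_iff] at hv ⊢
  simp only [grBasis_repr] at hv
  refine ⟨by rw [← hF.grCoord_of_apply_eq rfl hx]; exact hv.1, fun j hj hjv => ?_⟩
  rcases ((hF _ _).1 ξ.2 j hj).eq_or_lt with h | h
  · refine hv.2 j ?_ hjv
    rwa [hF.grCoord_of_apply_eq h hx]
  · rcases htri j v with h' | h' | h'
    · exact absurd h' hjv
    · exact h'
    · exact absurd (hr _ _ h') (not_le.2 h)

theorem principalSymbol_eq (hF : IsDegreeFiltration B deg F)
    (hr : ∀ i j, r i j → deg i ≤ deg j) {ξ : V} {v : ι} (hv : IsLeadingMonomial K B r ξ v)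
    (hξ : ξ ∈ F (deg v)) : principalSymbol F ξ =
      DirectSum.of (GrPiece F) (deg v) (GrPiece.mk F (deg v) ⟨ξ, hξ⟩) := by
  classical
  have hex : ∃ q, ξ ∈ F q := ⟨_, hξ⟩
  have hq : Nat.find hex = deg v := by
    rw [Nat.find_eq_iff]
    exact ⟨hξ, fun q hq h => absurd ((hF.mem_iff_of_isLeadingMonomial hr hv q).1 h) (not_le.2 hq)⟩
  rw [principalSymbol, dif_pos hex]
  -- The two classes lie in pieces whose indices are only propositionally equal, so they are
  -- compared as elements of the sigma type.
  exact DirectSum.of_eq_of_gradedMonoid_eq (GrPiece.sigma_mk_eq F hq _ _ rfl)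

/-! #### The Rees module -/

/-- The element `B i` of the Rees module, in degree `deg i + k`. -/
noncomputable def reesVec {J : Type*} (hF : IsDegreeFiltration B deg F) (p : J → ι) (k : J → ℕ) (j : J) :
    ReesModule F :=
  DirectSum.of (fun q => F q) (deg (p j) + k j)
    ⟨B (p j), (hF.basis_mem_iff _ _).2 (Nat.le_add_right _ _)⟩

/-- The coordinates of an element of the Rees module. -/
noncomputable def reesCoord {J : Type*} (B : Module.Basis ι K V) (deg : ι → ℕ)
    (F : ℕ → Submodule K V) (p : J → ι) (k : J → ℕ) (j : J) :
    ReesModule F →ₗ[K] K :=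
  B.coord (p j) ∘ₗ (F (deg (p j) + k j)).subtype ∘ₗ
    DirectSum.component K ℕ (fun q => F q) (deg (p j) + k j)

theorem reesCoord_apply {J : Type*} (p : J → ι) (k : J → ℕ) (j : J) (x : ReesModule F) :
    reesCoord B deg F p k j x = B.repr (x (deg (p j) + k j)) (p j) := rfl

theorem reesCoord_of {J : Type*} (p : J → ι) (k : J → ℕ) (j : J) (q : ℕ) (ξ : F q) :
    reesCoord B deg F p k j (DirectSum.of (fun q => F q) q ξ) =
      if deg (p j) + k j = q then B.repr ξ (p j) else 0 := by
  rw [reesCoord_apply]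
  split_ifs with h
  · subst h
    rw [DirectSum.of_eq_same]
  · rw [DirectSum.of_eq_of_ne _ _ _ h, ZeroMemClass.coe_zero, map_zero, Finsupp.zero_apply]

variable {J : Type*} {p : J → ι} {k : J → ℕ}

/-- The conditions `hinj` and `hsurj` make `j ↦ (p j, k j)` a bijection from `J` to `ι × ℕ`. Leaving
`J` abstract allows exponent vectors with one more entry, for `Z`, to serve as indices. -/
theorem reesCoord_reesVec [DecidableEq J] (hF : IsDegreeFiltration B deg F)
    (hinj : ∀ i j, p i = p j → k i = k j → i = j) (i j : J) :
    reesCoord B deg F p k i (hF.reesVec p k j) = if j = i then 1 else 0 := by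
  classical
  rw [reesVec, reesCoord_of, B.repr_self, Finsupp.single_apply]
  by_cases h : j = i
  · simp [h]
  · rw [if_neg h]
    split_ifs with h1 h2
    -- Equal basis elements in equal total degrees have equal `Z`-exponents.
    · exact absurd (hinj _ _ h2 (by rw [h2] at h1; omega)) h
    · rfl
    · rfl

theorem linearIndependent_reesVec (hF : IsDegreeFiltration B deg F)
    (hinj : ∀ i j, p i = p j → k i = k j → i = j) : LinearIndependent K (hF.reesVec p k) := by
  classical
  refine LinearIndependent.of_pairwise_dual_eq_zero_one _ (reesCoord B deg F p k)
    (fun i j hij => ?_) (fun i => ?_)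
  · change reesCoord B deg F p k i (hF.reesVec p k j) = 0
    rw [hF.reesCoord_reesVec hinj, if_neg (Ne.symm hij)]
  · rw [hF.reesCoord_reesVec hinj, if_pos rfl]

/-- The basis of the Rees module given by the elements of `B` placed in all possible degrees. -/
noncomputable def reesBasis (hF : IsDegreeFiltration B deg F)
    (hinj : ∀ i j, p i = p j → k i = k j → i = j) (hsurj : ∀ i l, ∃ j, p j = i ∧ k j = l) :
    Module.Basis J K (ReesModule F) :=
  Module.Basis.mk (v := hF.reesVec p k)
    (hF.linearIndependent_reesVec hinj)
    (by
      rintro x -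
      induction x using DirectSum.induction_on with
      | zero => exact zero_mem _
      | add x y hx hy => exact add_mem hx hy
      | of q x =>
        obtain ⟨ξ, hξ⟩ := x
        rw [hF.eq_sum_basis hξ, ← DirectSum.lof_eq_of K, map_sum]
        refine Submodule.sum_mem _ fun i _ => ?_
        rw [map_smul]
        refine Submodule.smul_mem _ _ (Submodule.subset_span ?_)
        have hi : deg i ≤ q := (hF q ξ).1 hξ i (Finsupp.mem_support_iff.1 i.2)
        -- The element `B i` in degree `q` needs `Z`-exponent `q - deg i`; by `hi` the subtraction
        -- is not truncated.
        obtain ⟨j, hj, hk⟩ := hsurj i (q - deg i)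
        obtain rfl : deg (p j) + k j = q := by rw [hj, hk]; omega
        refine ⟨j, ?_⟩
        rw [reesVec, DirectSum.lof_eq_of]
        congr 1
        exact Subtype.ext (congrArg B hj))

theorem coe_reesBasis (hF : IsDegreeFiltration B deg F)
    (hinj : ∀ i j, p i = p j → k i = k j → i = j) (hsurj : ∀ i l, ∃ j, p j = i ∧ k j = l) :
    ⇑(hF.reesBasis hinj hsurj) = hF.reesVec p k :=
  Module.Basis.coe_mk _ _

theorem reesBasis_repr (hF : IsDegreeFiltration B deg F)
    (hinj : ∀ i j, p i = p j → k i = k j → i = j) (hsurj : ∀ i l, ∃ j, p j = i ∧ k j = l)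
    (x : ReesModule F) (j : J) :
    (hF.reesBasis hinj hsurj).repr x j = reesCoord B deg F p k j x := by
  classical
  have h : (hF.reesBasis hinj hsurj).coord j = reesCoord B deg F p k j := by
    refine (hF.reesBasis hinj hsurj).ext fun l => ?_
    rw [Module.Basis.coord_apply, Module.Basis.repr_self, Finsupp.single_apply, coe_reesBasis,
      hF.reesCoord_reesVec hinj]
  exact LinearMap.congr_fun h x

/-- The ordering of the elements of the basis of the Rees module. -/
def lexRel (r : ι → ι → Prop) (p : J → ι) (k : J → ℕ) (i j : J) : Prop :=
  r (p i) (p j) ∨ (p i = p j ∧ k i < k j)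

theorem lexRel_asymm (hasymm : ∀ i j, r i j → ¬ r j i) (i j : J) (h : lexRel r p k i j) :
    ¬ lexRel r p k j i := by
  rintro (h' | ⟨h', h''⟩)
  · rcases h with h | ⟨h, -⟩
    · exact hasymm _ _ h h'
    · rw [h] at h'
      exact hasymm _ _ h' h'
  · rcases h with h | ⟨-, h⟩
    · rw [h'] at h
      exact hasymm _ _ h h
    · omega

theorem lexRel_trans (htrans : ∀ i j l, r i j → r j l → r i l) (i j l : J)
    (h : lexRel r p k i j) (h' : lexRel r p k j l) : lexRel r p k i l := by
  rcases h with h | ⟨h, h1⟩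
  · rcases h' with h' | ⟨h', -⟩
    · exact Or.inl (htrans _ _ _ h h')
    · exact Or.inl (h' ▸ h)
  · rcases h' with h' | ⟨h', h2⟩
    · exact Or.inl (h ▸ h')
    · exact Or.inr ⟨h.trans h', h1.trans h2⟩

theorem lexRel_trichotomous (htri : ∀ i j, i = j ∨ r i j ∨ r j i)
    (hinj : ∀ i j, p i = p j → k i = k j → i = j) (i j : J) :
    i = j ∨ lexRel r p k i j ∨ lexRel r p k j i := by
  rcases htri (p i) (p j) with h | h | h
  · rcases lt_trichotomy (k i) (k j) with h' | h' | h'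
    · exact Or.inr (Or.inl (Or.inr ⟨h, h'⟩))
    · exact Or.inl (hinj _ _ h h')
    · exact Or.inr (Or.inr (Or.inr ⟨h.symm, h'⟩))
  · exact Or.inr (Or.inl (Or.inl h))
  · exact Or.inr (Or.inr (Or.inl h))

/-- Within one degree `q` the `Z`-exponent is determined by the underlying monomial, so ties in
`lexRel` do not occur and it reduces to `r`. -/
theorem isLeadingMonomial_reesVec_of (hF : IsDegreeFiltration B deg F)
    (hinj : ∀ i j, p i = p j → k i = k j → i = j) (hsurj : ∀ i l, ∃ j, p j = i ∧ k j = l)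
    {ξ : V} {j : J} {q : ℕ} (hv : IsLeadingMonomial K B r ξ (p j)) (hq : deg (p j) + k j = q)
    (hξ : ξ ∈ F q) :
    IsLeadingMonomial K (hF.reesVec p k) (lexRel r p k)
      (DirectSum.of (fun q => F q) q ⟨ξ, hξ⟩) j := by
  rw [← hF.coe_reesBasis hinj hsurj]
  rw [isLeadingMonomial_iff] at hv ⊢
  simp only [reesBasis_repr, reesCoord_of]
  refine ⟨by simpa [hq] using hv.1, fun l hl hlj => ?_⟩
  split_ifs at hl with h
  · refine Or.inl (hv.2 _ hl fun h' => hlj (hinj _ _ h' ?_))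
    rw [h'] at h
    omega
  · exact absurd rfl hl

/-- Each monomial of the component in degree `deg (p j) + k j` is a monomial of `x` for a suitable
power of `Z`. The tie-breaking case of `lexRel` would force its underlying monomial to be `p j`. -/
theorem isLeadingMonomial_of_reesVec (hF : IsDegreeFiltration B deg F)
    (hinj : ∀ i j, p i = p j → k i = k j → i = j) (hsurj : ∀ i l, ∃ j, p j = i ∧ k j = l)
    {x : ReesModule F} {j : J} (hv : IsLeadingMonomial K (hF.reesVec p k) (lexRel r p k) x j) :
    IsLeadingMonomial K B r (x (deg (p j) + k j) : V) (p j) := by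
  rw [← hF.coe_reesBasis hinj hsurj] at hv
  rw [isLeadingMonomial_iff] at hv ⊢
  simp only [reesBasis_repr, reesCoord_apply] at hv
  refine ⟨hv.1, fun i hi hij => ?_⟩
  have hd := (hF _ _).1 (x (deg (p j) + k j)).2 i hi
  obtain ⟨l, rfl, hk⟩ := hsurj i (deg (p j) + k j - deg i)
  have hl : deg (p l) + k l = deg (p j) + k j := by rw [hk]; omega
  rcases hv.2 l (by rwa [hl]) (fun h => hij (by rw [h])) with h | h
  · exact h
  · exact absurd h.1 hij

theorem reesElement_eq (hF : IsDegreeFiltration B deg F)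
    (hr : ∀ i j, r i j → deg i ≤ deg j) {ξ : V} {v : ι} (hv : IsLeadingMonomial K B r ξ v)
    (hξ : ξ ∈ F (deg v)) :
    reesElement F ξ = DirectSum.of (fun q => F q) (deg v) ⟨ξ, hξ⟩ := by
  classical
  have hex : ∃ q, ξ ∈ F q := ⟨_, hξ⟩
  have hq : Nat.find hex = deg v := by
    rw [Nat.find_eq_iff]
    exact ⟨hξ, fun q hq h => absurd ((hF.mem_iff_of_isLeadingMonomial hr hv q).1 h) (not_le.2 hq)⟩
  rw [reesElement, dif_pos hex]
  -- The membership proof depends on `Nat.find hex`, so it is generalized before the degree is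
  -- replaced.
  generalize_proofs h1
  revert h1
  generalize Nat.find hex = m at hq ⊢
  subst hq
  intro _
  rfl

end IsDegreeFiltration

/-! ### Monomials in graded rings -/

section Monomials

theorem pbwMonomial_succ {R : Type*} [Semiring R] {n : ℕ} (x : Fin (n + 1) → R)
    (α : Fin (n + 1) → ℕ) : pbwMonomial x α =
      x 0 ^ α 0 * pbwMonomial (fun i => x i.succ) (fun i => α i.succ) := by
  rw [pbwMonomial, List.ofFn_succ, List.prod_cons]
  rfl

theorem pbwMonomial_castSucc {R : Type*} [Semiring R] {n : ℕ} (x : Fin (n + 1) → R)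
    (α : Fin (n + 1) → ℕ) : pbwMonomial x α =
      pbwMonomial (fun i => x i.castSucc) (fun i => α i.castSucc) *
        x (Fin.last n) ^ α (Fin.last n) := by
  rw [pbwMonomial, List.ofFn_succ', List.concat_eq_append, List.prod_append, List.prod_singleton]
  rfl

theorem pbwMonomial_zero {R : Type*} [Semiring R] {n : ℕ} (x : Fin n → R) :
    pbwMonomial x 0 = 1 := by
  simp [pbwMonomial]

theorem pbwMonomial_single {R : Type*} [Semiring R] {n : ℕ} (x : Fin n → R) (i : Fin n) :
    pbwMonomial x (Pi.single i 1) = x i := by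
  induction n with
  | zero => exact i.elim0
  | succ n ih =>
    rw [pbwMonomial_succ]
    induction i using Fin.cases with
    | zero =>
      have h : (fun j : Fin n => (Pi.single (0 : Fin (n + 1)) 1 : Fin (n + 1) → ℕ) j.succ) = 0 := by
        ext j
        simp
      rw [h, pbwMonomial_zero]
      simp
    | succ i =>
      have h : (fun j : Fin n => (Pi.single i.succ 1 : Fin (n + 1) → ℕ) j.succ) =
          Pi.single i 1 := by
        ext j
        simp [Pi.single_apply]
      rw [h, ih (fun j => x j.succ)]
      simp

theorem monomialDegree_single {n : ℕ} (m : Fin n → ℕ) (i : Fin n) :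
    monomialDegree m (Pi.single i 1) = m i := by
  simp [monomialDegree, Pi.single_apply]

variable {R R' : Type*} [Semiring R] [Semiring R'] {H : ℕ → R → R' → Prop}

/-- Read `H p a x` as "`x` represents `a` in degree `p`". The relation is abstract so that one
induction serves both `IsGrClass` and `IsReesLift`. -/
theorem graded_rel_pow (h1 : H 0 1 1)
    (hmul : ∀ p q a b x y, H p a x → H q b y → H (p + q) (a * b) (x * y)) {p : ℕ} {a : R} {x : R'}
    (h : H p a x) (k : ℕ) : H (k * p) (a ^ k) (x ^ k) := by
  induction k with
  | zero => simpa using h1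
  | succ k ih =>
    rw [pow_succ, pow_succ, Nat.succ_mul]
    exact hmul _ _ _ _ _ _ ih h

theorem graded_rel_pbwMonomial (h1 : H 0 1 1)
    (hmul : ∀ p q a b x y, H p a x → H q b y → H (p + q) (a * b) (x * y)) {n : ℕ} {x : Fin n → R}
    {y : Fin n → R'} {m : Fin n → ℕ} (h : ∀ i, H (m i) (x i) (y i)) (α : Fin n → ℕ) :
    H (monomialDegree m α) (pbwMonomial x α) (pbwMonomial y α) := by
  induction n with
  | zero => simpa [monomialDegree, pbwMonomial] using h1
  | succ n ih =>
    rw [pbwMonomial_succ, pbwMonomial_succ, monomialDegree, Fin.sum_univ_succ]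
    exact hmul _ _ _ _ _ _ (graded_rel_pow h1 hmul (h 0) _)
      (ih (fun i => h i.succ) (fun i => α i.succ))

end Monomials

/-- Uniqueness of leading monomials removes the algebra from left division, leaving a condition on
exponents that can be compared across the three modules. -/
theorem monomialLeftDvd_iff {K R M : Type*} [Field K] [Semiring R] [AddCommMonoid M]
    [Module R M] [Module K M] {n s : ℕ} {x : Fin n → R} {e : Fin s → M}
    {r : (Fin n → ℕ) × Fin s → (Fin n → ℕ) × Fin s → Prop}
    (huniq : ∀ y i j, IsLeadingMonomial K (moduleMonomial x e) r y i →
      IsLeadingMonomial K (moduleMonomial x e) r y j → i = j)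
    (hmul : ∀ γ u, IsLeadingMonomial K (moduleMonomial x e) r
      (pbwMonomial x γ • moduleMonomial x e u) (γ + u.1, u.2))
    (u v : (Fin n → ℕ) × Fin s) :
    MonomialLeftDvd K x e r u v ↔ u.2 = v.2 ∧ ∃ γ, v.1 = γ + u.1 := by
  refine and_congr_right fun huv => exists_congr fun γ => ⟨fun h => ?_, fun h => ?_⟩
  · rw [← huniq _ _ _ (hmul γ u) h]
  · have : v = (γ + u.1, u.2) := Prod.ext h huv.symm
    rw [this]
    exact hmul γ u

/-! ### Homogeneous representatives in the associated graded and Rees modules -/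

section Homogeneous

variable {K A V : Type*} [Field K] [Ring A] [Algebra K A] [AddCommGroup V] [Module K V]
  [Module A V] {F : ℕ → Submodule K A} {FV : ℕ → Submodule K V}
  [SetLike.GradedMonoid F] [SetLike.GradedSMul F FV]

/-- `x` is the class of `ξ` in degree `q` of the associated graded module. -/
def IsGrClass (FV : ℕ → Submodule K V) (q : ℕ) (ξ : V) (x : AssocGraded FV) : Prop :=
  ∃ h : ξ ∈ FV q, x = DirectSum.of (GrPiece FV) q (GrPiece.mk FV q ⟨ξ, h⟩)

/-- `x` is the element `ξ` placed in degree `q` of the Rees module. -/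
def IsReesLift (FV : ℕ → Submodule K V) (q : ℕ) (ξ : V) (x : ReesModule FV) : Prop :=
  ∃ h : ξ ∈ FV q, x = DirectSum.of (fun q => FV q) q ⟨ξ, h⟩

theorem IsGrClass.one : IsGrClass F 0 1 1 := ⟨SetLike.GradedOne.one_mem, rfl⟩

theorem IsGrClass.mul (p q : ℕ) (f g : A) (x y : AssocGraded F) (hx : IsGrClass F p f x)
    (hy : IsGrClass F q g y) : IsGrClass F (p + q) (f * g) (x * y) := by
  obtain ⟨hf, rfl⟩ := hx
  obtain ⟨hg, rfl⟩ := hy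
  exact ⟨SetLike.GradedMul.mul_mem hf hg, DirectSum.of_mul_of _ _⟩

theorem IsReesLift.one : IsReesLift F 0 1 1 := ⟨SetLike.GradedOne.one_mem, rfl⟩

theorem IsReesLift.mul (p q : ℕ) (f g : A) (x y : ReesModule F) (hx : IsReesLift F p f x)
    (hy : IsReesLift F q g y) : IsReesLift F (p + q) (f * g) (x * y) := by
  obtain ⟨hf, rfl⟩ := hx
  obtain ⟨hg, rfl⟩ := hy
  exact ⟨SetLike.GradedMul.mul_mem hf hg, DirectSum.of_mul_of _ _⟩

theorem IsReesLift.smul {p q : ℕ} {f : A} {ξ : V} {x : ReesModule F} {y : ReesModule FV}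
    (hx : IsReesLift F p f x) (hy : IsReesLift FV q ξ y) :
    IsReesLift FV (p + q) (f • ξ) (x • y) := by
  obtain ⟨hf, rfl⟩ := hx
  obtain ⟨hg, rfl⟩ := hy
  exact ⟨SetLike.GradedSMul.smul_mem (A := F) (B := FV) hf hg,
    DirectSum.Gmodule.of_smul_of _ _ _ _⟩

theorem principalSymbol_zero (FV : ℕ → Submodule K V) : principalSymbol FV 0 = 0 := by
  classical
  rw [principalSymbol, dif_pos ⟨0, zero_mem _⟩]
  exact (congrArg _ (map_zero _)).trans (map_zero _)

theorem reesElement_zero (FV : ℕ → Submodule K V) : reesElement FV 0 = 0 := by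
  classical
  rw [reesElement, dif_pos ⟨0, zero_mem _⟩]
  exact map_zero _

variable (F) in
theorem IsReesLift.mem_reesSubmodule {N : Submodule A V} {q : ℕ} {ξ : V}
    {x : ReesModule FV} (hx : IsReesLift FV q ξ x) (hξ : ξ ∈ N) :
    x ∈ reesSubmodule F FV N := by
  obtain ⟨h, rfl⟩ := hx
  intro t
  by_cases hqt : q = t
  · subst hqt
    rw [DirectSum.of_eq_same]
    exact hξ
  · rw [DirectSum.of_eq_of_ne _ _ _ (Ne.symm hqt)]
    exact N.zero_mem

variable [IsScalarTower K A V]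

theorem IsGrClass.smul {p q : ℕ} {f : A} {ξ : V} {x : AssocGraded F} {y : AssocGraded FV}
    (hx : IsGrClass F p f x) (hy : IsGrClass FV q ξ y) : IsGrClass FV (p + q) (f • ξ) (x • y) := by
  obtain ⟨hf, rfl⟩ := hx
  obtain ⟨hg, rfl⟩ := hy
  exact ⟨SetLike.GradedSMul.smul_mem (A := F) (B := FV) hf hg,
    DirectSum.Gmodule.of_smul_of _ _ _ _⟩

variable (F) in
theorem IsGrClass.mem_assocGradedSubmodule {N : Submodule A V} {q : ℕ} {ξ : V}
    {x : AssocGraded FV} (hx : IsGrClass FV q ξ x) (hξ : ξ ∈ N) :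
    x ∈ assocGradedSubmodule F FV N := by
  obtain ⟨h, rfl⟩ := hx
  intro t
  by_cases hqt : q = t
  · subst hqt
    exact ⟨⟨ξ, h⟩, hξ, DirectSum.of_eq_same _ _⟩
  · exact ⟨0, N.zero_mem, by rw [DirectSum.of_eq_of_ne _ _ _ (Ne.symm hqt), map_zero]⟩

end Homogeneous

theorem isLeadingMonomial_basis_self {K ι V : Type*} [Field K] [AddCommGroup V] [Module K V]
    {r : ι → ι → Prop} (B : Module.Basis ι K V) (i : ι) : IsLeadingMonomial K B r (B i) i := by
  classical
  rw [isLeadingMonomial_iff, B.repr_self]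
  refine ⟨by simp, fun j hj hji => ?_⟩
  rw [Finsupp.single_eq_of_ne hji] at hj
  exact absurd rfl hj

/-! ### Solvable polynomial algebras -/

namespace GradedSolvableAlgebra

variable {K A L : Type*} [Field K] [Ring A] [Algebra K A] [AddCommGroup L] [Module K L]
  [Module A L] [IsScalarTower K A L] {n s : ℕ}

/-- The PBW basis. -/
noncomputable def pbwBasis (S : GradedSolvableAlgebra K A n) : Module.Basis (Fin n → ℕ) K A :=
  Module.Basis.mk S.linearIndependent_pbw S.span_pbw.ge

theorem coe_pbwBasis (S : GradedSolvableAlgebra K A n) : ⇑S.pbwBasis = pbwMonomial S.gen :=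
  Module.Basis.coe_mk _ _

/-- The `K`-basis of the free module consisting of the monomials `a ^ α • eᵢ`. -/
noncomputable def monomialBasis (S : GradedSolvableAlgebra K A n) (e : Module.Basis (Fin s) A L) :
    Module.Basis ((Fin n → ℕ) × Fin s) K L :=
  S.pbwBasis.smulTower e

theorem coe_monomialBasis (S : GradedSolvableAlgebra K A n) (e : Module.Basis (Fin s) A L) :
    ⇑(S.monomialBasis e) = moduleMonomial S.gen e := by
  ext u
  rw [monomialBasis, Module.Basis.smulTower_apply, coe_pbwBasis]
  rfl

theorem isDegreeFiltration (S : GradedSolvableAlgebra K A n) :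
    IsDegreeFiltration S.pbwBasis S.degree S.filtration :=
  .of_eq_span fun q => by rw [coe_pbwBasis]; rfl

/-- The degree of the monomial `a ^ α • eᵢ`. -/
def moduleDegree (S : GradedSolvableAlgebra K A n) (b : Fin s → ℕ) (u : (Fin n → ℕ) × Fin s) : ℕ :=
  S.degree u.1 + b u.2

theorem isDegreeFiltration_module (S : GradedSolvableAlgebra K A n)
    (e : Module.Basis (Fin s) A L) (b : Fin s → ℕ) :
    IsDegreeFiltration (S.monomialBasis e) (S.moduleDegree b) (S.moduleFiltration e b) :=
  .of_eq_span fun q => by rw [coe_monomialBasis]; rfl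

theorem degree_add (S : GradedSolvableAlgebra K A n) (α β : Fin n → ℕ) :
    S.degree (α + β) = S.degree α + S.degree β := by
  simp [degree, monomialDegree, add_mul, Finset.sum_add_distrib]

theorem isLeadingMonomial_mul (S : GradedSolvableAlgebra K A n) (α β : Fin n → ℕ) :
    IsLeadingMonomial K S.pbwBasis S.lt (pbwMonomial S.gen α * pbwMonomial S.gen β) (α + β) := by
  classical
  have := S.isMonomialOrdering.isWellOrder
  obtain ⟨c, hc, f, hf, hlt⟩ := S.solvable α β
  -- The whole tail `f` lies below `α + β`, so it cannot cancel the coefficient `c` there.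
  have hsupp : ∀ j, S.pbwBasis.repr f j ≠ 0 → S.lt j (α + β) := by
    intro j hj
    have h0 : f ≠ 0 := by
      rintro rfl
      simp at hj
    obtain ⟨μ, hμ, h⟩ := hlt h0
    rw [← coe_pbwBasis, isLeadingMonomial_iff] at hμ
    by_cases hjμ : j = μ
    · rwa [hjμ]
    · exact _root_.trans (hμ.2 j hj hjμ) h
  have hrepr : S.pbwBasis.repr (pbwMonomial S.gen α * pbwMonomial S.gen β) =
      Finsupp.single (α + β) c + S.pbwBasis.repr f := by
    rw [hf, map_add, map_smul, ← coe_pbwBasis, Module.Basis.repr_self, Finsupp.smul_single,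
      smul_eq_mul, mul_one]
  rw [isLeadingMonomial_iff, hrepr]
  constructor
  · have : S.pbwBasis.repr f (α + β) = 0 := by
      by_contra h
      exact irrefl_of S.lt _ (hsupp _ h)
    rw [Finsupp.add_apply, Finsupp.single_eq_same, this, add_zero]
    exact hc
  · intro j hj hne
    rw [Finsupp.add_apply, Finsupp.single_eq_of_ne hne, zero_add] at hj
    exact hsupp j hj

variable (S : GradedSolvableAlgebra K A n) (e : Module.Basis (Fin s) A L) (b : Fin s → ℕ)
  {r : (Fin n → ℕ) × Fin s → (Fin n → ℕ) × Fin s → Prop}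

/-- The product stays in the component of `e u.2`, where its coordinates are those of a product in
`A`; on one component `r` extends `S.lt`. -/
theorem isLeadingMonomial_smul (hr : S.IsGradedLeftMonomialOrdering e b r) (γ : Fin n → ℕ)
    (u : (Fin n → ℕ) × Fin s) : IsLeadingMonomial K (S.monomialBasis e) r
      (pbwMonomial S.gen γ • moduleMonomial S.gen e u) (γ + u.1, u.2) := by
  classical
  have h := S.isLeadingMonomial_mul γ u.1
  rw [isLeadingMonomial_iff] at h ⊢
  have hrepr : ∀ j, (S.monomialBasis e).repr (pbwMonomial S.gen γ • moduleMonomial S.gen e u) j =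
      if u.2 = j.2 then S.pbwBasis.repr (pbwMonomial S.gen γ * pbwMonomial S.gen u.1) j.1
      else 0 := by
    intro j
    rw [moduleMonomial, smul_smul, monomialBasis, Module.Basis.smulTower_repr, map_smul,
      e.repr_self, Finsupp.smul_single, smul_eq_mul, mul_one, Finsupp.single_apply]
    split_ifs
    · rfl
    · simp
  simp only [hrepr]
  refine ⟨by simpa using h.1, ?_⟩
  rintro ⟨α, i⟩ hj hne
  split_ifs at hj with hi
  · obtain rfl : u.2 = i := hi
    exact hr.lt_of_algebra_lt _ _ _ (h.2 α hj fun hα => hne (by rw [hα]))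
  · exact absurd rfl hj

theorem gen_eq (i : Fin n) : S.gen i = S.pbwBasis (Pi.single i 1) := by
  rw [coe_pbwBasis, pbwMonomial_single]

theorem isLeadingMonomial_gen (i : Fin n) :
    IsLeadingMonomial K S.pbwBasis S.lt (S.gen i) (Pi.single i 1) := by
  rw [gen_eq]
  exact isLeadingMonomial_basis_self _ _

theorem degree_single (i : Fin n) : S.degree (Pi.single i 1) = S.weight i :=
  monomialDegree_single _ _

theorem isLeadingMonomial_basis (i : Fin s) :
    IsLeadingMonomial K (S.monomialBasis e) r (e i) (0, i) := by
  have h : e i = S.monomialBasis e (0, i) := by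
    rw [coe_monomialBasis, moduleMonomial, pbwMonomial_zero, one_smul]
  rw [h]
  exact isLeadingMonomial_basis_self _ _

theorem moduleDegree_zero (i : Fin s) : S.moduleDegree b (0, i) = b i := by
  simp [moduleDegree, degree, monomialDegree]

/-! #### Monomials of the associated graded module -/

theorem isGrClass_principalSymbol {ι V : Type*} [AddCommGroup V] [Module K V] {r : ι → ι → Prop}
    {B : Module.Basis ι K V} {deg : ι → ℕ} {F : ℕ → Submodule K V}
    (hF : IsDegreeFiltration B deg F) (hr : ∀ i j, r i j → deg i ≤ deg j) {ξ : V} {v : ι}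
    (hv : IsLeadingMonomial K B r ξ v) : IsGrClass F (deg v) ξ (principalSymbol F ξ) :=
  ⟨(hF.mem_iff_of_isLeadingMonomial hr hv _).2 le_rfl, hF.principalSymbol_eq hr hv _⟩

theorem isReesLift_reesElement {ι V : Type*} [AddCommGroup V] [Module K V] {r : ι → ι → Prop}
    {B : Module.Basis ι K V} {deg : ι → ℕ} {F : ℕ → Submodule K V}
    (hF : IsDegreeFiltration B deg F) (hr : ∀ i j, r i j → deg i ≤ deg j) {ξ : V} {v : ι}
    (hv : IsLeadingMonomial K B r ξ v) : IsReesLift F (deg v) ξ (reesElement F ξ) :=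
  ⟨(hF.mem_iff_of_isLeadingMonomial hr hv _).2 le_rfl, hF.reesElement_eq hr hv _⟩

theorem isGrClass_pbwMonomial (α : Fin n → ℕ) :
    IsGrClass S.filtration (S.degree α) (pbwMonomial S.gen α) (pbwMonomial S.grGen α) := by
  refine graded_rel_pbwMonomial IsGrClass.one IsGrClass.mul (fun i => ?_) α
  rw [← degree_single]
  exact isGrClass_principalSymbol S.isDegreeFiltration S.degree_le_of_lt (S.isLeadingMonomial_gen i)

theorem isGrClass_moduleMonomial (hr : S.IsGradedLeftMonomialOrdering e b r)
    (u : (Fin n → ℕ) × Fin s) :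
    IsGrClass (S.moduleFiltration e b) (S.moduleDegree b u) (moduleMonomial S.gen e u)
      (moduleMonomial S.grGen (S.grBasis e b) u) := by
  refine (S.isGrClass_pbwMonomial u.1).smul ?_
  rw [← S.moduleDegree_zero b]
  exact isGrClass_principalSymbol (S.isDegreeFiltration_module e b) hr.degree_le_of_lt
    (S.isLeadingMonomial_basis e u.2)

/-- This identifies the abstract basis of classes with the products of symbols, so the latter form a
`K`-basis of `G(L)`. -/
theorem grVec_eq (hr : S.IsGradedLeftMonomialOrdering e b r) :
    (S.isDegreeFiltration_module e b).grVec = moduleMonomial S.grGen (S.grBasis e b) := by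
  ext1 u
  obtain ⟨h, hu⟩ := S.isGrClass_moduleMonomial e b hr u
  rw [hu, IsDegreeFiltration.grVec]
  simp only [coe_monomialBasis]

/-! #### Monomials of the Rees module -/

/-- A power `Z ^ k` is `1` in degree `k`: it raises the degree and leaves the underlying element of
`A` unchanged. -/
theorem isReesLift_pbwMonomial (α : Fin (n + 1) → ℕ) :
    IsReesLift S.filtration (S.degree (fun i => α i.castSucc) + α (Fin.last n))
      (pbwMonomial S.gen (fun i => α i.castSucc)) (pbwMonomial S.reesGen α) := by
  rw [pbwMonomial_castSucc S.reesGen]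
  have h1 : IsReesLift S.filtration (S.degree (fun i => α i.castSucc))
      (pbwMonomial S.gen (fun i => α i.castSucc))
      (pbwMonomial (fun i => S.reesGen i.castSucc) (fun i => α i.castSucc)) := by
    refine graded_rel_pbwMonomial IsReesLift.one IsReesLift.mul (fun i => ?_) _
    rw [← degree_single, reesGen, Fin.snoc_castSucc]
    exact isReesLift_reesElement S.isDegreeFiltration S.degree_le_of_lt
      (S.isLeadingMonomial_gen i)
  have hZ : IsReesLift S.filtration 1 1 (S.reesGen (Fin.last n)) := by
    rw [reesGen, Fin.snoc_last]
    exact ⟨S.one_mem_filtration 1, rfl⟩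
  have h2 := graded_rel_pow IsReesLift.one IsReesLift.mul hZ (α (Fin.last n))
  have h3 := IsReesLift.mul _ _ _ _ _ _ h1 h2
  rwa [one_pow, mul_one, mul_one] at h3

/-- The monomial of `L` underlying a monomial of the Rees module. -/
def dehomogenize (u : (Fin (n + 1) → ℕ) × Fin s) : (Fin n → ℕ) × Fin s :=
  (fun i => u.1 i.castSucc, u.2)

/-- The exponent of `Z` in a monomial of the Rees module. -/
def expZ (u : (Fin (n + 1) → ℕ) × Fin s) : ℕ := u.1 (Fin.last n)

theorem eq_of_dehomogenize_eq (u v : (Fin (n + 1) → ℕ) × Fin s)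
    (h : dehomogenize u = dehomogenize v) (hk : expZ u = expZ v) : u = v := by
  have h1 := congrArg Prod.fst h
  have h2 := congrArg Prod.snd h
  refine Prod.ext (funext fun i => ?_) h2
  induction i using Fin.lastCases with
  | last => exact hk
  | cast i => exact congrFun h1 i

/-- The monomial of the Rees module with underlying monomial `u` and exponent `k` of `Z`. -/
def homogenize (u : (Fin n → ℕ) × Fin s) (k : ℕ) : (Fin (n + 1) → ℕ) × Fin s :=
  (Fin.snoc (α := fun _ => ℕ) u.1 k, u.2)

theorem dehomogenize_homogenize (u : (Fin n → ℕ) × Fin s) (k : ℕ) :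
    dehomogenize (homogenize u k) = u := by
  simp [dehomogenize, homogenize]

theorem expZ_homogenize (u : (Fin n → ℕ) × Fin s) (k : ℕ) : expZ (homogenize u k) = k := by
  simp [expZ, homogenize]

theorem exists_dehomogenize_eq (u : (Fin n → ℕ) × Fin s) (k : ℕ) :
    ∃ v, dehomogenize v = u ∧ expZ v = k :=
  ⟨homogenize u k, dehomogenize_homogenize u k, expZ_homogenize u k⟩

theorem isReesLift_moduleMonomial (hr : S.IsGradedLeftMonomialOrdering e b r)
    (u : (Fin (n + 1) → ℕ) × Fin s) :
    IsReesLift (S.moduleFiltration e b) (S.moduleDegree b (dehomogenize u) + expZ u)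
      (moduleMonomial S.gen e (dehomogenize u))
      (moduleMonomial S.reesGen (S.reesBasis e b) u) := by
  have h := (S.isReesLift_pbwMonomial u.1).smul (isReesLift_reesElement
    (S.isDegreeFiltration_module e b) hr.degree_le_of_lt (S.isLeadingMonomial_basis e u.2))
  rw [S.moduleDegree_zero b, add_right_comm] at h
  exact h

theorem reesVec_eq (hr : S.IsGradedLeftMonomialOrdering e b r) :
    (S.isDegreeFiltration_module e b).reesVec dehomogenize expZ =
      moduleMonomial S.reesGen (S.reesBasis e b) := by
  ext1 u
  obtain ⟨h, hu⟩ := S.isReesLift_moduleMonomial e b hr u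
  rw [hu, IsDegreeFiltration.reesVec]
  simp only [coe_monomialBasis]

end GradedSolvableAlgebra

namespace GradedSolvableAlgebra

variable {K A L : Type*} [Field K] [Ring A] [Algebra K A] [AddCommGroup L] [Module K L]
  [Module A L] {n s : ℕ} {S : GradedSolvableAlgebra K A n}
  {e : Module.Basis (Fin s) A L} {b : Fin s → ℕ}
  {r : (Fin n → ℕ) × Fin s → (Fin n → ℕ) × Fin s → Prop}

theorem IsGradedLeftMonomialOrdering.asymm
    (hr : S.IsGradedLeftMonomialOrdering e b r)
    (u v : (Fin n → ℕ) × Fin s) (h : r u v) : ¬ r v u := by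
  have := hr.isStrictTotalOrder
  exact asymm_of r h

theorem IsGradedLeftMonomialOrdering.trans
    (hr : S.IsGradedLeftMonomialOrdering e b r)
    (u v w : (Fin n → ℕ) × Fin s) (h : r u v) (h' : r v w) : r u w := by
  have := hr.isStrictTotalOrder
  exact trans_of r h h'

theorem IsGradedLeftMonomialOrdering.trichotomous
    (hr : S.IsGradedLeftMonomialOrdering e b r)
    (u v : (Fin n → ℕ) × Fin s) : u = v ∨ r u v ∨ r v u := by
  have := hr.isStrictTotalOrder
  rcases trichotomous_of r u v with h | h | h
  · exact Or.inr (Or.inl h)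
  · exact Or.inl h
  · exact Or.inr (Or.inr h)

variable [IsScalarTower K A L]

/-! #### Left division of monomials -/

variable (S e b)

theorem monomialLeftDvd_gen_iff (hr : S.IsGradedLeftMonomialOrdering e b r)
    (u v : (Fin n → ℕ) × Fin s) :
    MonomialLeftDvd K S.gen e r u v ↔ u.2 = v.2 ∧ ∃ γ, v.1 = γ + u.1 := by
  have h := S.coe_monomialBasis e
  refine monomialLeftDvd_iff ?_ ?_ u v
  · intro y i j hi hj
    rw [← h] at hi hj
    exact hi.unique hr.asymm hj
  · intro γ u
    have h' := S.isLeadingMonomial_smul e b hr γ u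
    rwa [h] at h'

theorem monomialLeftDvd_grGen_iff (hr : S.IsGradedLeftMonomialOrdering e b r)
    (u v : (Fin n → ℕ) × Fin s) :
    MonomialLeftDvd K S.grGen (S.grBasis e b) r u v ↔ u.2 = v.2 ∧ ∃ γ, v.1 = γ + u.1 := by
  have hF := S.isDegreeFiltration_module e b
  refine monomialLeftDvd_iff ?_ ?_ u v
  · intro y i j hi hj
    rw [← S.grVec_eq e b hr, ← hF.coe_grBasis] at hi hj
    exact hi.unique hr.asymm hj
  · intro γ u
    obtain ⟨hmem, h⟩ := (S.isGrClass_pbwMonomial γ).smul (S.isGrClass_moduleMonomial e b hr u)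
    rw [h, ← S.grVec_eq e b hr]
    -- The product of the classes lies in the degree of the leading monomial of the product, so that
    -- monomial survives in the quotient.
    have hdeg : S.degree γ + S.moduleDegree b u = S.moduleDegree b (γ + u.1, u.2) := by
      simp only [moduleDegree, degree_add, add_assoc]
    revert hmem
    rw [hdeg]
    intro hmem _
    exact hF.isLeadingMonomial_grVec_of_mk (S.isLeadingMonomial_smul e b hr γ u) hmem

theorem monomialLeftDvd_reesGen_iff (hr : S.IsGradedLeftMonomialOrdering e b r)
    (u v : (Fin (n + 1) → ℕ) × Fin s) :
    MonomialLeftDvd K S.reesGen (S.reesBasis e b) (reesOrdering r) u v ↔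
      u.2 = v.2 ∧ ∃ γ, v.1 = γ + u.1 := by
  have hF := S.isDegreeFiltration_module e b
  refine monomialLeftDvd_iff ?_ ?_ u v
  · intro y i j hi hj
    rw [← S.reesVec_eq e b hr,
      ← hF.coe_reesBasis eq_of_dehomogenize_eq exists_dehomogenize_eq] at hi hj
    -- `reesOrdering r` unfolds to `lexRel r dehomogenize expZ`.
    exact hi.unique (IsDegreeFiltration.lexRel_asymm (p := dehomogenize) (k := expZ) hr.asymm) hj
  · intro γ u
    obtain ⟨hmem, h⟩ := (S.isReesLift_pbwMonomial γ).smul (S.isReesLift_moduleMonomial e b hr u)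
    rw [h, ← S.reesVec_eq e b hr]
    refine hF.isLeadingMonomial_reesVec_of (p := dehomogenize) (k := expZ)
      eq_of_dehomogenize_eq exists_dehomogenize_eq (S.isLeadingMonomial_smul e b hr _ _) ?_ hmem
    change S.degree ((fun i => γ i.castSucc) + fun i => u.1 i.castSucc) + b u.2 +
      (γ (Fin.last n) + u.1 (Fin.last n)) = S.degree _ + γ (Fin.last n) +
        (S.degree (fun i => u.1 i.castSucc) + b u.2 + u.1 (Fin.last n))
    rw [degree_add]
    ring

/-! #### Left Gröbner bases -/

theorem isLeftGroebnerBasis_iff_principalSymbol (hr : S.IsGradedLeftMonomialOrdering e b r)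
    (N : Submodule A L) (G : Set L) (hG : G ⊆ N) :
    IsLeftGroebnerBasis K S.gen e r N G ↔
      IsLeftGroebnerBasis K S.grGen (S.grBasis e b) r
        (assocGradedSubmodule S.filtration (S.moduleFiltration e b) N)
        (principalSymbol (S.moduleFiltration e b) '' G) := by
  have hF := S.isDegreeFiltration_module e b
  have hB := S.coe_monomialBasis e
  have hsymb : ∀ ξ v, IsLeadingMonomial K (S.monomialBasis e) r ξ v →
      IsLeadingMonomial K hF.grVec r (principalSymbol (S.moduleFiltration e b) ξ) v := by
    intro ξ v hv
    obtain ⟨hmem, h⟩ := isGrClass_principalSymbol hF hr.degree_le_of_lt hv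
    rw [h]
    exact hF.isLeadingMonomial_grVec_of_mk hv hmem
  have hmemN : ∀ ξ ∈ N, ∀ v, IsLeadingMonomial K (S.monomialBasis e) r ξ v →
      principalSymbol (S.moduleFiltration e b) ξ ∈
        assocGradedSubmodule S.filtration (S.moduleFiltration e b) N := fun ξ hξ v hv =>
    (isGrClass_principalSymbol hF hr.degree_le_of_lt hv).mem_assocGradedSubmodule _ hξ
  have hex : ∀ ξ : L, ξ ≠ 0 → ∃ v, IsLeadingMonomial K (S.monomialBasis e) r ξ v := fun ξ hξ =>
    exists_isLeadingMonomial _ hr.trichotomous hr.trans hξ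
  simp only [IsLeftGroebnerBasis, monomialLeftDvd_gen_iff S e b hr,
    monomialLeftDvd_grGen_iff S e b hr, ← S.grVec_eq e b hr, ← hB]
  constructor
  · rintro ⟨h1, h2⟩
    constructor
    · rintro _ ⟨g, hg, rfl⟩
      obtain ⟨hgN, hg0⟩ := h1 g hg
      obtain ⟨v, hv⟩ := hex g hg0
      refine ⟨hmemN g hgN v hv, ?_⟩
      have hv' := hsymb g v hv
      rw [← hF.coe_grBasis] at hv'
      exact hv'.ne_zero
    · intro x hx hx0
      obtain ⟨v, hv⟩ := exists_isLeadingMonomial hF.grBasis hr.trichotomous hr.trans hx0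
      rw [hF.coe_grBasis] at hv
      -- Although `x` may be inhomogeneous, its component in the degree of `v` is the class of some
      -- `ξ ∈ N`, and this `ξ` has leading monomial `v`.
      obtain ⟨ξ, hξN, hξ⟩ := hx (S.moduleDegree b v)
      have hξv := hF.isLeadingMonomial_of_grVec hr.trichotomous hr.degree_le_of_lt hv hξ
      obtain ⟨g, hg, u, w, hu, hw, huw⟩ := h2 ξ hξN hξv.ne_zero
      obtain rfl := hw.unique hr.asymm hξv
      exact ⟨_, ⟨g, hg, rfl⟩, u, w, hsymb g u hu, hv, huw⟩
  · rintro ⟨h1, h2⟩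
    have hne : ∀ g ∈ G, g ≠ 0 := by
      rintro _ hg rfl
      -- If `0 ∈ G`, then `σ(0) = 0` would be an element of a left Gröbner basis.
      exact (h1 _ ⟨0, hg, rfl⟩).2 (principalSymbol_zero _)
    have huniq : ∀ y i j, IsLeadingMonomial K hF.grVec r y i →
        IsLeadingMonomial K hF.grVec r y j → i = j := by
      intro y i j hi hj
      rw [← hF.coe_grBasis] at hi hj
      exact hi.unique hr.asymm hj
    refine ⟨fun g hg => ⟨hG hg, hne g hg⟩, fun ξ hξ hξ0 => ?_⟩
    obtain ⟨v, hv⟩ := hex ξ hξ0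
    have hv' := hsymb ξ v hv
    have hσ0 : principalSymbol (S.moduleFiltration e b) ξ ≠ 0 := by
      rw [← hF.coe_grBasis] at hv'
      exact hv'.ne_zero
    obtain ⟨_, ⟨g, hg, rfl⟩, u, w, hu, hw, huw⟩ := h2 _ (hmemN ξ hξ v hv) hσ0
    obtain ⟨u', hu'⟩ := hex g (hne g hg)
    obtain rfl := huniq _ _ _ hw hv'
    obtain rfl := huniq _ _ _ hu (hsymb g u' hu')
    exact ⟨g, hg, u, w, hu', hv, huw⟩

/-- The divisor has `Z`-exponent `0`, so the `Z`-entry of the cofactor can always be taken to be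
`k`. -/
theorem exists_add_homogenize_iff (u v : (Fin n → ℕ) × Fin s) (k : ℕ) :
    ((homogenize u 0).2 = (homogenize v k).2 ∧
      ∃ γ, (homogenize v k).1 = γ + (homogenize u 0).1) ↔ u.2 = v.2 ∧ ∃ γ, v.1 = γ + u.1 := by
  refine and_congr_right fun _ => ⟨?_, ?_⟩
  · rintro ⟨γ, hγ⟩
    refine ⟨fun i => γ i.castSucc, funext fun i => ?_⟩
    simpa [homogenize] using congrFun hγ i.castSucc
  · rintro ⟨γ, hγ⟩
    refine ⟨Fin.snoc (α := fun _ => ℕ) γ k, funext fun i => ?_⟩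
    induction i using Fin.lastCases with
    | last => simp [homogenize]
    | cast i => simpa [homogenize] using congrFun hγ i

theorem isLeftGroebnerBasis_iff_reesElement (hr : S.IsGradedLeftMonomialOrdering e b r)
    (N : Submodule A L) (G : Set L) (hG : G ⊆ N) :
    IsLeftGroebnerBasis K S.gen e r N G ↔
      IsLeftGroebnerBasis K S.reesGen (S.reesBasis e b) (reesOrdering r)
        (reesSubmodule S.filtration (S.moduleFiltration e b) N)
        (reesElement (S.moduleFiltration e b) '' G) := by
  have hF := S.isDegreeFiltration_module e b
  have hB := S.coe_monomialBasis e
  have hinj := eq_of_dehomogenize_eq (n := n) (s := s)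
  have hsurj := exists_dehomogenize_eq (n := n) (s := s)
  have hV := hF.coe_reesBasis hinj hsurj
  -- The exponent of `Z` is `0` because `ξ` is placed in its filtered degree, which is the degree of
  -- `v`.
  have hlift : ∀ ξ v, IsLeadingMonomial K (S.monomialBasis e) r ξ v →
      IsLeadingMonomial K (hF.reesBasis hinj hsurj) (reesOrdering r)
        (reesElement (S.moduleFiltration e b) ξ) (homogenize v 0) := by
    intro ξ v hv
    obtain ⟨hmem, h⟩ := isReesLift_reesElement hF hr.degree_le_of_lt hv
    rw [h, hV]
    refine hF.isLeadingMonomial_reesVec_of hinj hsurj ?_ ?_ hmem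
    · rwa [dehomogenize_homogenize]
    · rw [dehomogenize_homogenize, expZ_homogenize, add_zero]
  have hmemN : ∀ ξ ∈ N, ∀ v, IsLeadingMonomial K (S.monomialBasis e) r ξ v →
      reesElement (S.moduleFiltration e b) ξ ∈
        reesSubmodule S.filtration (S.moduleFiltration e b) N := fun ξ hξ v hv =>
    (isReesLift_reesElement hF hr.degree_le_of_lt hv).mem_reesSubmodule _ hξ
  have hex : ∀ ξ : L, ξ ≠ 0 → ∃ v, IsLeadingMonomial K (S.monomialBasis e) r ξ v := fun ξ hξ =>
    exists_isLeadingMonomial _ hr.trichotomous hr.trans hξ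
  have hasymm : ∀ i j, reesOrdering r i j → ¬ reesOrdering r j i :=
    IsDegreeFiltration.lexRel_asymm (p := dehomogenize) (k := expZ) hr.asymm
  simp only [IsLeftGroebnerBasis, monomialLeftDvd_gen_iff S e b hr,
    monomialLeftDvd_reesGen_iff S e b hr, ← S.reesVec_eq e b hr, ← hB, ← hV]
  constructor
  · rintro ⟨h1, h2⟩
    constructor
    · rintro _ ⟨g, hg, rfl⟩
      obtain ⟨hgN, hg0⟩ := h1 g hg
      obtain ⟨v, hv⟩ := hex g hg0
      exact ⟨hmemN g hgN v hv, (hlift g v hv).ne_zero⟩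
    · intro x hx hx0
      obtain ⟨v, hv⟩ := exists_isLeadingMonomial (r := reesOrdering r) (hF.reesBasis hinj hsurj)
        (IsDegreeFiltration.lexRel_trichotomous (p := dehomogenize) (k := expZ)
          hr.trichotomous hinj)
        (IsDegreeFiltration.lexRel_trans (p := dehomogenize) (k := expZ) hr.trans) hx0
      -- The component of `x` in the total degree of `v` lies in `N` and has `dehomogenize v` as
      -- leading monomial.
      have hξv := hF.isLeadingMonomial_of_reesVec hinj hsurj (hV ▸ hv)
      obtain ⟨g, hg, u, w, hu, hw, huw⟩ := h2 _ (hx _) hξv.ne_zero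
      obtain rfl := hw.unique hr.asymm hξv
      refine ⟨_, ⟨g, hg, rfl⟩, homogenize u 0, v, hlift g u hu, hv, ?_⟩
      -- Restoring the `Z`-exponent of `v` turns divisibility of underlying monomials into
      -- divisibility of `v` itself.
      have hhom : homogenize (dehomogenize v) (expZ v) = v :=
        hinj _ _ (dehomogenize_homogenize _ _) (expZ_homogenize _ _)
      rw [← exists_add_homogenize_iff u (dehomogenize v) (expZ v), hhom] at huw
      exact huw
  · rintro ⟨h1, h2⟩
    have hne : ∀ g ∈ G, g ≠ 0 := by
      rintro _ hg rfl
      exact (h1 _ ⟨0, hg, rfl⟩).2 (reesElement_zero _)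
    refine ⟨fun g hg => ⟨hG hg, hne g hg⟩, fun ξ hξ hξ0 => ?_⟩
    obtain ⟨v, hv⟩ := hex ξ hξ0
    have hv' := hlift ξ v hv
    obtain ⟨_, ⟨g, hg, rfl⟩, u, w, hu, hw, huw⟩ := h2 _ (hmemN ξ hξ v hv) hv'.ne_zero
    obtain ⟨u', hu'⟩ := hex g (hne g hg)
    obtain rfl := hw.unique hasymm hv'
    obtain rfl := hu.unique hasymm (hlift g u' hu')
    exact ⟨g, hg, u', v, hu', hv, (exists_add_homogenize_iff u' v 0).1 huw⟩

end GradedSolvableAlgebra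

theorem theorem5p3p3 {K A L : Type*} [Field K] [Ring A] [Algebra K A] [AddCommGroup L]
    [Module K L] [Module A L] [IsScalarTower K A L] {n s : ℕ}
    (S : GradedSolvableAlgebra K A n) (e : Module.Basis (Fin s) A L) (b : Fin s → ℕ)
    (r : (Fin n → ℕ) × Fin s → (Fin n → ℕ) × Fin s → Prop)
    (hr : S.IsGradedLeftMonomialOrdering e b r)
    (N : Submodule A L) (G : Set L) (hG : G ⊆ N) :
    (IsLeftGroebnerBasis K S.gen e r N G ↔
      IsLeftGroebnerBasis K S.grGen (S.grBasis e b) r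
        (assocGradedSubmodule S.filtration (S.moduleFiltration e b) N)
        (principalSymbol (S.moduleFiltration e b) '' G)) ∧
    (IsLeftGroebnerBasis K S.gen e r N G ↔
      IsLeftGroebnerBasis K S.reesGen (S.reesBasis e b) (reesOrdering r)
        (reesSubmodule S.filtration (S.moduleFiltration e b) N)
        (reesElement (S.moduleFiltration e b) '' G)) :=
  ⟨S.isLeftGroebnerBasis_iff_principalSymbol e b hr N G hG,
    S.isLeftGroebnerBasis_iff_reesElement e b hr N G hG⟩
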